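/- Let $n\ge 2$ and let $\mathbb{S}^n$ be the unit sphere of $\mathbb{R}^{n+1}$ with its spherical (great-circle) metric $d$. A homeomorphism $f:\mathbb{S}^n\to\mathbb{S}^n$ is \emph{bilipschitz} if there is $L>0$ with $d(x,y)/L\le d(f(x),f(y))\le L\,d(x,y)$ for all $x,y$. A homeomorphism $g$ between open subsets of $\mathbb{R}^n$ is \emph{$K$-quasiconformal} ($K<\infty$) if $$\limsup_{\epsilon\to 0^+}\frac{\sup\{|g(y)-g(x)|:|y-x|=\epsilon\}}{\inf\{|g(y)-g(x)|:|y-x|=\epsilon\}}<K$$ for every point $x$ of its domain, and a homeomorphism $f:\mathbb{S}^n\to\mathbb{S}^n$ is \emph{quasiconformal} if there is $K<\infty$ such that, for every pair $\varphi,\psi$ of stereographic charts of $\mathbb{S}^n$, the map $\psi\circ f\circ\varphi^{-1}$ is $K$-quasiconformal where it is defined. Let $\mathrm{QC}(\mathbb{S}^n)$ and $\mathrm{LIP}(\mathbb{S}^n)$ be the groups, under composition, of orientation preserving (i.e. of degree $1$) quasiconformal, respectively bilipschitz, homeomorphisms of $\mathbb{S}^n$. Let $\mathrm{G}(\mathbb{S}^n)$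 be either $\mathrm{QC}(\mathbb{S}^n)$ or $\mathrm{LIP}(\mathbb{S}^n)$, and let $\mathrm{G}_0(\mathbb{S}^n)$ be the set of those $g\in\mathrm{G}(\mathbb{S}^n)$ that are the identity outside some open ball $\{x\in\mathbb{S}^n: d(x,c)<\epsilon\}$ with $c\in\mathbb{S}^n$ and $0<\epsilon<\pi$. Then the subgroup of $\mathrm{G}(\mathbb{S}^n)$ generated by $\mathrm{G}_0(\mathbb{S}^n)$ is simple. -/

import Mathlib

open scoped NNReal ENNReal

noncomputable section

namespace SphereHomeo

/-- The unit sphere of `ℝⁿ⁺¹`. -/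
abbrev Sph (n : ℕ) : Type :=
  Metric.sphere (0 : EuclideanSpace ℝ (Fin (n + 1))) 1

/-- The spherical (great-circle) distance: the angle between two unit vectors. -/
def sphDist {n : ℕ} (x y : Sph n) : ℝ :=
  InnerProductGeometry.angle (x : EuclideanSpace ℝ (Fin (n + 1)))
    (y : EuclideanSpace ℝ (Fin (n + 1)))

/-- The open ball of radius `ε` about `c` in the spherical metric. -/
def sphBall {n : ℕ} (c : Sph n) (ε : ℝ) : Set (Sph n) :=
  {x | sphDist x c < ε}

/-- The basis of open balls with spherical radius in `(0, π)`. -/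
def openBalls (n : ℕ) : Set (Set (Sph n)) :=
  {B | ∃ (c : Sph n) (ε : ℝ), 0 < ε ∧ ε < Real.pi ∧ B = sphBall c ε}

/-- A homeomorphism of the `n`-sphere preserves orientation if it acts as the identity on
the top singular homology group `Hₙ(Sⁿ; ℤ)` (i.e. has degree `1`). -/
def OrientationPreserving {n : ℕ} (f : Sph n ≃ₜ Sph n) : Prop :=
  ((AlgebraicTopology.singularHomologyFunctor (ModuleCat.{0} ℤ) n).obj
      (ModuleCat.of ℤ ℤ)).map (TopCat.ofHom (f : C(Sph n, Sph n))) =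
    CategoryTheory.CategoryStruct.id _

/-- `f` is bilipschitz for the spherical metric. -/
def IsBilipschitz {n : ℕ} (f : Sph n ≃ₜ Sph n) : Prop :=
  ∃ L : ℝ, 0 < L ∧ ∀ x y : Sph n,
    sphDist (f x) (f y) ≤ L * sphDist x y ∧ sphDist x y / L ≤ sphDist (f x) (f y)

/-- The group `LIP(Sⁿ)` of orientation preserving bilipschitz homeomorphisms, as a set of
elements of the group of all homeomorphisms of the sphere. -/
def LIP (n : ℕ) : Set (Sph n ≃ₜ Sph n) :=
  {f | IsBilipschitz f ∧ OrientationPreserving f}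

/-- The linear dilatation
`limsup_{ε → 0} (sup_{|y - x| = ε} |g y - g x|) / (inf_{|y - x| = ε} |g y - g x|)`
of `g` at `x`, with values in `[0, ∞]`. It only depends on `g` near `x`. -/
def linearDilatation {n : ℕ} (g : EuclideanSpace ℝ (Fin n) → EuclideanSpace ℝ (Fin n))
    (x : EuclideanSpace ℝ (Fin n)) : ℝ≥0∞ :=
  Filter.limsup
    (fun ε : ℝ => (⨆ y ∈ Metric.sphere x ε, edist (g x) (g y)) /
      (⨅ y ∈ Metric.sphere x ε, edist (g x) (g y)))
    (nhdsWithin 0 (Set.Ioi 0))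

/-- `g` is `K`-quasiconformal on the set `Ω` (used for homeomorphisms between open sets). -/
def IsKQuasiconformalOn {n : ℕ} (K : ℝ≥0)
    (g : EuclideanSpace ℝ (Fin n) → EuclideanSpace ℝ (Fin n))
    (Ω : Set (EuclideanSpace ℝ (Fin n))) : Prop :=
  ∀ x ∈ Ω, linearDilatation g x < (K : ℝ≥0∞)

/-- A homeomorphism of the sphere is quasiconformal if, for some finite `K`, it is
`K`-quasiconformal in all pairs of charts of the standard atlas (the stereographic
projections from the points of the sphere), wherever the composition is defined. -/
def IsQuasiconformal {n : ℕ} (f : Sph n ≃ₜ Sph n) : Prop :=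
  ∃ K : ℝ≥0, ∀ φ ∈ atlas (EuclideanSpace ℝ (Fin n)) (Sph n),
    ∀ ψ ∈ atlas (EuclideanSpace ℝ (Fin n)) (Sph n),
      IsKQuasiconformalOn K (fun x => ψ (f (φ.symm x)))
        {x | x ∈ φ.target ∧ f (φ.symm x) ∈ ψ.source}

/-- The group `QC(Sⁿ)` of orientation preserving quasiconformal homeomorphisms, as a set of
elements of the group of all homeomorphisms of the sphere. -/
def QC (n : ℕ) : Set (Sph n ≃ₜ Sph n) :=
  {f | IsQuasiconformal f ∧ OrientationPreserving f}

/-- `g` is supported on `B`: it is the identity outside `B`. -/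
def SupportedOn {n : ℕ} (g : Sph n ≃ₜ Sph n) (B : Set (Sph n)) : Prop :=
  ∀ x, x ∉ B → g x = x

/-- The elements of `G` which are supported on open balls. -/
def ballSupported {n : ℕ} (G : Set (Sph n ≃ₜ Sph n)) : Set (Sph n ≃ₜ Sph n) :=
  {g | g ∈ G ∧ ∃ B ∈ openBalls n, SupportedOn g B}

/-- The group generated (under composition) by the elements of `G` supported on open balls. -/
def ballGenerated {n : ℕ} (G : Set (Sph n ≃ₜ Sph n)) : Subgroup (Sph n ≃ₜ Sph n) :=
  Subgroup.closure (ballSupported G)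

end SphereHomeo

end

/-! A homeomorphism is supported on an open ball exactly when it is the identity near some point
`q`. Stereographic projection from `q` turns it into a homeomorphism of `ℝⁿ` with bounded support,
and two facts about such maps give simplicity.

Each generator `g` is a single commutator of maps in the group that are also the identity near `q`
(`exists_commutator`). Choose the chart origin off the support of `g`, so that `g` is supported on
an annulus, and let `φ` be multiplication by a small `c` on a large ball, tapered to the identity.
The conjugates of `g` by powers of `φ` live on disjoint annuli shrinking to the origin. Their
infinite product `F` satisfies `F = g φ F φ⁻¹`, that is, `g = F φ F⁻¹ φ⁻¹`. The analytic point is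
that `F` stays in the class. Conjugation by a dilation preserves both Lipschitz constants and
dilatation, so every factor obeys the bound for `g`. At the limit point `F` distorts the distance to
the origin by at most a factor `c⁻¹`, as it preserves every shell.

Elements of the group can squeeze the complement of any ball about `q` into any neighbourhood of any
point other than `q` (`exists_squeeze`). Given a nontrivial normal subgroup `N`, take an element
moving a point `x ≠ q`, hence displacing a neighbourhood of `x`. Conjugating by a squeeze yields an
element of `N` displacing the supports of both `F` and `φ`, and then `commutator_mem_of_displaced`
puts their commutator `g` in `N`.

Orientation is automatic: a homeomorphism that is the identity near `q` is homotopic to the identity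
along straight lines in the chart. -/

namespace SphereHomeo

/-! ### Radial bilipschitz homeomorphisms of a normed space. -/

section Radial

variable {E : Type*} [NormedAddCommGroup E] [NormedSpace ℝ E]

/-- The map multiplying the norm by means of `ρ` and keeping the directions. -/
noncomputable def radialMap (ρ : ℝ → ℝ) (x : E) : E := (ρ ‖x‖ / ‖x‖) • x

theorem norm_radialMap {ρ : ℝ → ℝ} (h0 : ρ 0 = 0) (hρ : ∀ t, 0 ≤ t → 0 ≤ ρ t) (x : E) :
    ‖radialMap ρ x‖ = ρ ‖x‖ := by
  rcases eq_or_ne x 0 with rfl | hx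
  · simp [radialMap, h0]
  · have : 0 < ‖x‖ := norm_pos_iff.2 hx
    rw [radialMap, norm_smul, Real.norm_of_nonneg (div_nonneg (hρ _ this.le) this.le)]
    field_simp

theorem radialMap_leftInverse {ρ τ : ℝ → ℝ} (h0 : ρ 0 = 0) (hρ : ∀ t, 0 ≤ t → 0 ≤ ρ t)
    (hτ : τ 0 = 0) (h : ∀ t, 0 ≤ t → τ (ρ t) = t) (x : E) :
    radialMap τ (radialMap ρ x) = x := by
  rw [radialMap, norm_radialMap h0 hρ, h _ (norm_nonneg x), radialMap, smul_smul]
  rcases eq_or_ne x 0 with rfl | hx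
  · simp
  · have : 0 < ‖x‖ := norm_pos_iff.2 hx
    have h1 : ρ ‖x‖ ≠ 0 := by
      intro h2
      have := h _ (norm_nonneg x)
      rw [h2, hτ] at this
      linarith
    have : ‖x‖ / ρ ‖x‖ * (ρ ‖x‖ / ‖x‖) = 1 := by field_simp
    rw [this, one_smul]

/-- Write the difference as the scale at `x` applied to `x - y`, plus the difference of scales
applied to `y`. Since `ρ 0 = 0`, scales are at most `M`; the first term costs `M`, the second `2 *
M`. -/
theorem dist_radialMap_le {ρ : ℝ → ℝ} {M : ℝ} (h0 : ρ 0 = 0)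
    (hM : ∀ t u, |ρ t - ρ u| ≤ M * |t - u|) (x y : E) :
    dist (radialMap ρ x) (radialMap ρ y) ≤ 3 * M * dist x y := by
  have hb : ∀ z : E, |ρ ‖z‖| ≤ M * ‖z‖ := fun z => by simpa [h0] using hM ‖z‖ 0
  have hM0 : 0 ≤ M := by simpa using (abs_nonneg _).trans (hM 1 0)
  have hone : ∀ z : E, ‖radialMap ρ z‖ ≤ M * ‖z‖ := by
    intro z
    rcases eq_or_ne z 0 with rfl | hz
    · simp [radialMap]
    · have : 0 < ‖z‖ := norm_pos_iff.2 hz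
      rw [radialMap, norm_smul, norm_div, norm_norm, Real.norm_eq_abs]
      have h2 := hb z
      field_simp
      linarith
  rcases eq_or_ne x 0 with rfl | hx
  · have : radialMap ρ (0 : E) = 0 := by simp [radialMap]
    rw [this, dist_zero_left, dist_zero_left]
    have := hone y
    nlinarith [mul_nonneg hM0 (norm_nonneg y)]
  rcases eq_or_ne y 0 with rfl | hy
  · have : radialMap ρ (0 : E) = 0 := by simp [radialMap]
    rw [this, dist_zero_right, dist_zero_right]
    have := hone x
    nlinarith [mul_nonneg hM0 (norm_nonneg x)]
  have hx' : 0 < ‖x‖ := norm_pos_iff.2 hx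
  have hy' : 0 < ‖y‖ := norm_pos_iff.2 hy
  rw [dist_eq_norm, dist_eq_norm]
  have e : radialMap ρ x - radialMap ρ y =
      (ρ ‖x‖ / ‖x‖) • (x - y) + (ρ ‖x‖ / ‖x‖ - ρ ‖y‖ / ‖y‖) • y := by
    simp only [radialMap]; module
  have hn : |‖x‖ - ‖y‖| ≤ ‖x - y‖ := abs_norm_sub_norm_le x y
  have hq : |ρ ‖x‖ / ‖x‖| ≤ M := by
    rw [abs_div, abs_norm, div_le_iff₀ hx']; exact hb x
  have h1 : ‖(ρ ‖x‖ / ‖x‖) • (x - y)‖ ≤ M * ‖x - y‖ := by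
    rw [norm_smul, Real.norm_eq_abs]
    exact mul_le_mul_of_nonneg_right hq (norm_nonneg _)
  have h2 : ‖(ρ ‖x‖ / ‖x‖ - ρ ‖y‖ / ‖y‖) • y‖ ≤ 2 * M * ‖x - y‖ := by
    rw [norm_smul, Real.norm_eq_abs]
    have e2 : |ρ ‖x‖ / ‖x‖ - ρ ‖y‖ / ‖y‖| * ‖y‖ =
        |ρ ‖x‖ / ‖x‖ * (‖y‖ - ‖x‖) + (ρ ‖x‖ - ρ ‖y‖)| := by
      rw [← abs_of_pos hy', ← abs_mul, abs_of_pos hy']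
      congr 1
      field_simp
      ring
    rw [e2]
    calc _ ≤ |ρ ‖x‖ / ‖x‖| * |‖y‖ - ‖x‖| + |ρ ‖x‖ - ρ ‖y‖| := by
            rw [← abs_mul]; exact abs_add_le _ _
      _ ≤ M * ‖x - y‖ + M * ‖x - y‖ := by
            rw [abs_sub_comm ‖y‖]
            refine add_le_add ?_ ((hM _ _).trans ?_) <;> gcongr
      _ = _ := by ring
  rw [e]
  calc _ ≤ _ := norm_add_le _ _
    _ ≤ 3 * M * ‖x - y‖ := by linarith

/-- Multiplication by `c` up to `r`, followed by a linear interpolation to the identity. -/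
noncomputable def shrinkProfile (c r t : ℝ) : ℝ :=
  min t (max (c * t) ((2 - c) * t - 2 * r * (1 - c)))

/-- The inverse of `shrinkProfile c r`. -/
noncomputable def expandProfile (c r u : ℝ) : ℝ :=
  max u (min (u / c) ((u + 2 * r * (1 - c)) / (2 - c)))

section Profile

variable {c r : ℝ}

theorem shrinkProfile_of_le (hc : c < 1) {t : ℝ} (ht0 : 0 ≤ t) (ht : t ≤ r) :
    shrinkProfile c r t = c * t := by
  rw [shrinkProfile, max_eq_left (by nlinarith), min_eq_right (by nlinarith)]

theorem shrinkProfile_of_ge (hc : c < 1) {t : ℝ} (ht : 2 * r ≤ t) :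
    shrinkProfile c r t = t := by
  rw [shrinkProfile, min_eq_left]
  exact le_max_of_le_right (by nlinarith)

theorem shrinkProfile_of_mem (hc : c < 1) {t : ℝ} (ht : r ≤ t) (ht' : t ≤ 2 * r) :
    shrinkProfile c r t = (2 - c) * t - 2 * r * (1 - c) := by
  rw [shrinkProfile, max_eq_right (by nlinarith), min_eq_right (by nlinarith)]

theorem expandProfile_of_le (hc0 : 0 < c) (hc : c < 1) {u : ℝ} (hu0 : 0 ≤ u) (hu : u ≤ c * r) :
    expandProfile c r u = u / c := by
  have h : u / c ≤ (u + 2 * r * (1 - c)) / (2 - c) := by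
    rw [div_le_div_iff₀ hc0 (by linarith)]
    nlinarith
  rw [expandProfile, min_eq_left h, max_eq_right]
  rw [le_div_iff₀ hc0]; nlinarith

theorem expandProfile_of_mem (hc0 : 0 < c) (hc : c < 1) {u : ℝ} (hu : c * r ≤ u)
    (hu' : u ≤ 2 * r) : expandProfile c r u = (u + 2 * r * (1 - c)) / (2 - c) := by
  have h : (u + 2 * r * (1 - c)) / (2 - c) ≤ u / c := by
    rw [div_le_div_iff₀ (by linarith) hc0]
    nlinarith
  rw [expandProfile, min_eq_right h, max_eq_right]
  rw [le_div_iff₀ (by linarith)]; nlinarith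

theorem expandProfile_of_ge (hc : c < 1) {u : ℝ} (hu : 2 * r ≤ u) :
    expandProfile c r u = u := by
  rw [expandProfile, max_eq_left]
  refine min_le_of_right_le ?_
  rw [div_le_iff₀ (by linarith)]; nlinarith

theorem expandProfile_shrinkProfile (hc0 : 0 < c) (hc : c < 1) (t : ℝ)
    (ht : 0 ≤ t) : expandProfile c r (shrinkProfile c r t) = t := by
  rcases le_total t r with h | h
  · rw [shrinkProfile_of_le hc ht h, expandProfile_of_le hc0 hc (by positivity) (by gcongr)]
    field_simp
  rcases le_total t (2 * r) with h' | h'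
  · rw [shrinkProfile_of_mem hc h h', expandProfile_of_mem hc0 hc (by nlinarith) (by nlinarith),
      div_eq_iff (by linarith)]
    ring
  · rw [shrinkProfile_of_ge hc h', expandProfile_of_ge hc h']

theorem shrinkProfile_expandProfile (hc0 : 0 < c) (hc : c < 1) (u : ℝ)
    (hu : 0 ≤ u) : shrinkProfile c r (expandProfile c r u) = u := by
  rcases le_total u (c * r) with h | h
  · rw [expandProfile_of_le hc0 hc hu h, shrinkProfile_of_le hc (by positivity)
      (by rw [div_le_iff₀ hc0]; linarith)]
    field_simp
  rcases le_total u (2 * r) with h' | h'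
  · have h2 : 0 < 2 - c := by linarith
    rw [expandProfile_of_mem hc0 hc h h', shrinkProfile_of_mem hc
      (by rw [le_div_iff₀ h2]; nlinarith) (by rw [div_le_iff₀ h2]; nlinarith)]
    field_simp
    ring
  · rw [expandProfile_of_ge hc h', shrinkProfile_of_ge hc h']

theorem exists_lipschitzWith_linear (a b : ℝ) :
    ∃ M : ℝ≥0, LipschitzWith M (fun t : ℝ => a * t + b) :=
  ⟨‖a‖₊, LipschitzWith.of_dist_le_mul fun x y => by
    rw [Real.dist_eq, Real.dist_eq, show a * x + b - (a * y + b) = a * (x - y) by ring, abs_mul]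
    rfl⟩

/-- Writing the profile with `min` and `max` of affine functions makes the Lipschitz bound
immediate, with no cases. -/
theorem exists_abs_shrinkProfile_sub_le (c r : ℝ) :
    ∃ M : ℝ, ∀ t u, |shrinkProfile c r t - shrinkProfile c r u| ≤ M * |t - u| := by
  obtain ⟨M₁, h₁⟩ := exists_lipschitzWith_linear 1 0
  obtain ⟨M₂, h₂⟩ := exists_lipschitzWith_linear c 0
  obtain ⟨M₃, h₃⟩ := exists_lipschitzWith_linear (2 - c) (-(2 * r * (1 - c)))
  refine ⟨(max M₁ (max M₂ M₃) : ℝ≥0), fun t u => ?_⟩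
  have := (h₁.min (h₂.max h₃)).dist_le_mul t u
  simpa [shrinkProfile, Real.dist_eq, sub_eq_add_neg] using this

theorem exists_abs_expandProfile_sub_le (c r : ℝ) :
    ∃ M : ℝ, ∀ t u, |expandProfile c r t - expandProfile c r u| ≤ M * |t - u| := by
  obtain ⟨M₁, h₁⟩ := exists_lipschitzWith_linear 1 0
  obtain ⟨M₂, h₂⟩ := exists_lipschitzWith_linear c⁻¹ 0
  obtain ⟨M₃, h₃⟩ := exists_lipschitzWith_linear (2 - c)⁻¹ ((2 - c)⁻¹ * (2 * r * (1 - c)))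
  refine ⟨(max M₁ (max M₂ M₃) : ℝ≥0), fun t u => ?_⟩
  have := (h₁.max (h₂.min h₃)).dist_le_mul t u
  simpa only [expandProfile, Real.dist_eq, one_mul, add_zero, div_eq_inv_mul, mul_add] using this

end Profile

theorem continuous_of_dist_le_mul {X Y : Type*} [PseudoMetricSpace X] [PseudoMetricSpace Y]
    {f : X → Y} {M : ℝ} (h : ∀ x y, dist (f x) (f y) ≤ M * dist x y) : Continuous f :=
  (LipschitzWith.of_dist_le_mul (K := M.toNNReal) fun x y => (h x y).trans <| by
    gcongr; exact Real.le_coe_toNNReal M).continuous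

/-- A bilipschitz homeomorphism of `E` that multiplies by `c` on the ball of radius `r` and is
the identity outside the ball of radius `2 * r`. -/
theorem exists_shrink {c r : ℝ} (hc0 : 0 < c) (hc : c < 1) (hr : 0 < r) :
    ∃ φ : E ≃ₜ E, (∀ y, ‖y‖ ≤ r → φ y = c • y) ∧ (∀ y, 2 * r ≤ ‖y‖ → φ y = y) ∧
      (∀ y, r < ‖y‖ → c * r < ‖φ y‖) ∧
      (∃ M, ∀ x y, dist (φ x) (φ y) ≤ M * dist x y) ∧
      ∃ M, ∀ x y, dist (φ.symm x) (φ.symm y) ≤ M * dist x y := by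
  obtain ⟨M₁, h₁⟩ := exists_abs_shrinkProfile_sub_le c r
  obtain ⟨M₂, h₂⟩ := exists_abs_expandProfile_sub_le c r
  have z₁ : shrinkProfile c r 0 = 0 := by rw [shrinkProfile_of_le hc le_rfl hr.le, mul_zero]
  have z₂ : expandProfile c r 0 = 0 := by
    rw [expandProfile_of_le hc0 hc le_rfl (by positivity), zero_div]
  have p₁ : ∀ t, 0 ≤ t → 0 ≤ shrinkProfile c r t := fun t ht =>
    le_min ht (le_max_of_le_left (by positivity))
  have p₂ : ∀ t, 0 ≤ t → 0 ≤ expandProfile c r t := fun t ht => le_max_of_le_left ht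
  have l₁ := dist_radialMap_le (E := E) z₁ h₁
  have l₂ := dist_radialMap_le (E := E) z₂ h₂
  refine ⟨⟨⟨radialMap (shrinkProfile c r), radialMap (expandProfile c r),
    radialMap_leftInverse z₁ p₁ z₂ (expandProfile_shrinkProfile hc0 hc),
    radialMap_leftInverse z₂ p₂ z₁ (shrinkProfile_expandProfile hc0 hc)⟩,
    continuous_of_dist_le_mul l₁, continuous_of_dist_le_mul l₂⟩, ?_, ?_, ?_, ⟨_, l₁⟩, ⟨_, l₂⟩⟩
  · intro y hy
    change radialMap _ y = _
    rcases eq_or_ne y 0 with rfl | hy0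
    · simp [radialMap]
    · rw [radialMap, shrinkProfile_of_le hc (norm_nonneg y) hy,
        mul_div_cancel_right₀ _ (norm_ne_zero_iff.2 hy0)]
  · intro y hy
    change radialMap _ y = _
    rw [radialMap, shrinkProfile_of_ge hc hy, div_self (by linarith), one_smul]
  · intro y hy
    change _ < ‖radialMap _ y‖
    rw [norm_radialMap z₁ p₁, shrinkProfile]
    refine lt_min (by nlinarith) (lt_max_of_lt_left (by gcongr))

/-- A map which is Lipschitz inside and outside a ball is Lipschitz. -/
theorem dist_le_of_inside_of_outside {f : E → E} {M a : ℝ}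
    (h₁ : ∀ x y, ‖x‖ ≤ a → ‖y‖ ≤ a → dist (f x) (f y) ≤ M * dist x y)
    (h₂ : ∀ x y, a ≤ ‖x‖ → a ≤ ‖y‖ → dist (f x) (f y) ≤ M * dist x y) (x y : E) :
    dist (f x) (f y) ≤ M * dist x y := by
  have key : ∀ x y, ‖x‖ ≤ a → a ≤ ‖y‖ → dist (f x) (f y) ≤ M * dist x y := by
    intro x y hx hy
    have hc : ContinuousOn (fun t : ℝ => ‖AffineMap.lineMap x y t‖) (Set.Icc 0 1) := by
      refine Continuous.continuousOn ?_
      simp only [AffineMap.lineMap_apply_module]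
      fun_prop
    -- The segment from `x` to `y` crosses the sphere of radius `a`; distances along it add up, so
    -- the two estimates combine with no loss in `M`.
    obtain ⟨t, ht, hta⟩ := intermediate_value_Icc zero_le_one hc (show a ∈ _ by simp [hx, hy])
    set z : E := AffineMap.lineMap x y t
    have hxz := h₁ x z hx (le_of_eq hta)
    have hzy := h₂ z y (le_of_eq hta.symm) hy
    have hd : dist x z + dist z y = dist x y := by
      rw [dist_comm x z, dist_lineMap_left, dist_lineMap_right, Real.norm_of_nonneg ht.1,
        Real.norm_of_nonneg (sub_nonneg.2 ht.2)]
      ring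
    calc dist (f x) (f y) ≤ dist (f x) (f z) + dist (f z) (f y) := dist_triangle _ _ _
      _ ≤ M * dist x z + M * dist z y := add_le_add hxz hzy
      _ = M * dist x y := by rw [← hd]; ring
  rcases le_total ‖x‖ a with hx | hx <;> rcases le_total ‖y‖ a with hy | hy
  · exact h₁ x y hx hy
  · exact key x y hx hy
  · rw [dist_comm, dist_comm x]; exact key y x hy hx
  · exact h₂ x y hx hy

end Radial

/-! ### The infinite product of rescaled copies of an annular map. -/

section Swindle

/-- By injectivity, a point whose image lies in the fixed set `S` is itself fixed, so nothing
crosses the sphere of radius `a`. -/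
theorem norm_le_iff_of_fixed {E : Type*} [NormedAddCommGroup E] {g : E ≃ₜ E} {a : ℝ} {S : Set E}
    (hS : {y : E | ‖y‖ ≤ a} ⊆ S ∨ {y : E | a < ‖y‖} ⊆ S) (hg : ∀ y ∈ S, g y = y) (y : E) : ‖g y‖ ≤ a ↔ ‖y‖ ≤ a := by
  have hfix : y ∈ S ∨ g y ∈ S → g y = y := fun h =>
    h.elim (hg y) fun h => g.injective (hg _ h)
  rcases hS with hS | hS
  · constructor <;> intro h
    · rwa [hfix (Or.inr (hS h))] at h
    · rwa [hfix (Or.inl (hS h))]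
  · rw [← not_iff_not, not_le, not_le]
    constructor <;> intro h
    · rwa [hfix (Or.inr (hS h))] at h
    · rwa [hfix (Or.inl (hS h))]

variable {E : Type*} [NormedAddCommGroup E] [NormedSpace ℝ E] {b c r : ℝ}

open Classical in
/-- The composition of the first `k` conjugates of `g` under the powers of multiplication
by `c`, for a map `g` which is supported on the annulus between `c * r` and `r`. -/
noncomputable def annularProd (c r : ℝ) (g : E → E) : ℕ → E → E
  | 0, y => y
  | k + 1, y => if ‖y‖ ≤ c * r then c • annularProd c r g k (c⁻¹ • y) else g y

section Function

variable {g : E → E}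

theorem annularProd_succ_of_le (k : ℕ) {y : E} (hy : ‖y‖ ≤ c * r) :
    annularProd c r g (k + 1) y = c • annularProd c r g k (c⁻¹ • y) := if_pos hy

theorem annularProd_succ_of_lt (k : ℕ) {y : E} (hy : c * r < ‖y‖) :
    annularProd c r g (k + 1) y = g y := if_neg hy.not_ge

theorem annularProd_of_ge (hc : c < 1) (hr : 0 < r) (hg : ∀ y, ‖y‖ < b ∨ r ≤ ‖y‖ → g y = y)
    (k : ℕ) {y : E} (hy : r ≤ ‖y‖) : annularProd c r g k y = y := by
  cases k with
  | zero => rfl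
  | succ k => rw [annularProd_succ_of_lt k (by nlinarith), hg y (Or.inr hy)]

theorem norm_inv_smul_eq (hc0 : 0 < c) (y : E) : ‖c⁻¹ • y‖ = ‖y‖ / c := by
  rw [norm_smul, norm_inv, Real.norm_of_nonneg hc0.le, div_eq_inv_mul]

theorem lt_norm_inv_smul (hc0 : 0 < c) {a : ℝ} {y : E} : a < ‖c⁻¹ • y‖ ↔ c * a < ‖y‖ := by
  rw [norm_inv_smul_eq hc0, lt_div_iff₀ hc0, mul_comm]

theorem norm_inv_smul_le (hc0 : 0 < c) {a : ℝ} {y : E} : ‖c⁻¹ • y‖ ≤ a ↔ ‖y‖ ≤ c * a := by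
  rw [norm_inv_smul_eq hc0, div_le_iff₀ hc0, mul_comm]

theorem annularProd_succ_of_lt' (hc0 : 0 < c) (hc : c < 1) (hr : 0 < r)
    (hg : ∀ y, ‖y‖ < b ∨ r ≤ ‖y‖ → g y = y) (k : ℕ) {y : E} (hy : ‖y‖ < b) :
    annularProd c r g (k + 1) y = c • annularProd c r g k (c⁻¹ • y) := by
  rcases le_or_gt ‖y‖ (c * r) with h | h
  · exact annularProd_succ_of_le k h
  · rw [annularProd_succ_of_lt k h, hg y (Or.inl hy),
      annularProd_of_ge hc hr hg k ((lt_norm_inv_smul hc0).2 h).le, smul_inv_smul₀ hc0.ne']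

theorem annularProd_succ_eq (hc0 : 0 < c) (hr : 0 < r)
    (hg : ∀ y, ‖y‖ < b ∨ r ≤ ‖y‖ → g y = y) (hc : c < 1) (k : ℕ) :
    ∀ {y : E}, c ^ k * r < ‖y‖ → annularProd c r g (k + 1) y = annularProd c r g k y := by
  induction k with
  | zero =>
    intro y hy
    rw [pow_zero, one_mul] at hy
    rw [annularProd_of_ge hc hr hg _ hy.le, annularProd_of_ge hc hr hg _ hy.le]
  | succ k ih =>
    intro y hy
    rcases le_or_gt ‖y‖ (c * r) with h | h
    · rw [annularProd_succ_of_le _ h, annularProd_succ_of_le _ h, ih]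
      rw [lt_norm_inv_smul hc0, ← mul_assoc, ← pow_succ']
      exact hy
    · rw [annularProd_succ_of_lt _ h, annularProd_succ_of_lt _ h]

/-- The factors added after stage `k` act only inside the ball of radius `c ^ k * r`, so the product
has already stabilised outside it. -/
theorem annularProd_eq_of_le (hc0 : 0 < c) (hr : 0 < r)
    (hg : ∀ y, ‖y‖ < b ∨ r ≤ ‖y‖ → g y = y) (hc : c < 1) {k l : ℕ} (hkl : k ≤ l) {y : E}
    (hy : c ^ k * r < ‖y‖) : annularProd c r g l y = annularProd c r g k y := by
  induction l, hkl using Nat.le_induction with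
  | base => rfl
  | succ l hkl ih =>
    rw [annularProd_succ_eq hc0 hr hg hc l (lt_of_le_of_lt ?_ hy), ih]
    have := pow_le_pow_of_le_one hc0.le hc.le hkl
    gcongr

theorem norm_annularProd_le_iff (hc0 : 0 < c) (hc : c < 1) (hr : 0 < r)
    (h₁ : ∀ y, ‖g y‖ ≤ c * r ↔ ‖y‖ ≤ c * r) (h₂ : ∀ y, ‖g y‖ ≤ r ↔ ‖y‖ ≤ r) (k : ℕ) :
    ∀ (j : ℕ) (y : E), ‖annularProd c r g k y‖ ≤ c ^ j * r ↔ ‖y‖ ≤ c ^ j * r := by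
  induction k with
  | zero => intro j y; rfl
  | succ k ih =>
    intro j y
    have hcr : c * r ≤ r := by nlinarith
    have hns : ∀ x : E, ‖c • x‖ = c * ‖x‖ := fun x => by
      rw [norm_smul, Real.norm_of_nonneg hc0.le]
    rcases le_or_gt ‖y‖ (c * r) with h | h
    · rw [annularProd_succ_of_le k h, hns]
      cases j with
      | zero =>
        have h3 := (ih 0 (c⁻¹ • y)).2 (by rw [norm_inv_smul_le hc0]; linarith)
        rw [pow_zero, one_mul] at h3 ⊢
        exact iff_of_true (by nlinarith) (by linarith)
      | succ j =>
        rw [pow_succ', mul_assoc, mul_le_mul_iff_right₀ hc0, ih j, norm_inv_smul_le hc0]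
    · rw [annularProd_succ_of_lt k h]
      cases j with
      | zero => simpa using h₂ y
      | succ j =>
        have h3 : c ^ (j + 1) * r ≤ c * r := by
          have := pow_le_of_le_one hc0.le hc.le (Nat.succ_ne_zero j)
          gcongr
        have h4 : c * r < ‖g y‖ := by rw [← not_le, h₁, not_le]; exact h
        exact iff_of_false (by linarith) (by linarith)

theorem annularProd_leftInverse {g' : E → E} (hc0 : 0 < c) (hc : c < 1) (hr : 0 < r)
    (h₁ : ∀ y, ‖g y‖ ≤ c * r ↔ ‖y‖ ≤ c * r) (h₂ : ∀ y, ‖g y‖ ≤ r ↔ ‖y‖ ≤ r)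
    (h : ∀ y, g' (g y) = y) (k : ℕ) :
    ∀ y, annularProd c r g' k (annularProd c r g k y) = y := by
  induction k with
  | zero => intro y; rfl
  | succ k ih =>
    intro y
    have h3 := norm_annularProd_le_iff hc0 hc hr h₁ h₂ (k + 1) 1 y
    rw [pow_one] at h3
    rcases le_or_gt ‖y‖ (c * r) with hy | hy
    · rw [annularProd_succ_of_le k (h3.2 hy), annularProd_succ_of_le k hy,
        inv_smul_smul₀ hc0.ne', ih, smul_inv_smul₀ hc0.ne']
    · rw [annularProd_succ_of_lt k (by rw [← not_le, h3, not_le]; exact hy),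
        annularProd_succ_of_lt k hy, h]

/-- The constant does not grow with `k`: the factors have disjoint supports, and conjugation by a
dilation keeps `M`. The inside and outside bounds are glued along the sphere of radius `c * r`. -/
theorem dist_annularProd_le {M : ℝ} (hM1 : 1 ≤ M) (hc0 : 0 < c) (hc : c < 1) (hr : 0 < r)
    (hcr : c * r < b) (hg : ∀ y, ‖y‖ < b ∨ r ≤ ‖y‖ → g y = y)
    (hM : ∀ x y, dist (g x) (g y) ≤ M * dist x y) (k : ℕ) :
    ∀ x y, dist (annularProd c r g k x) (annularProd c r g k y) ≤ M * dist x y := by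
  induction k with
  | zero =>
    intro x y
    exact le_mul_of_one_le_left dist_nonneg hM1
  | succ k ih =>
    refine dist_le_of_inside_of_outside (a := c * r) ?_ ?_
    · intro x y hx hy
      rw [annularProd_succ_of_le k hx, annularProd_succ_of_le k hy, dist_smul₀]
      have := ih (c⁻¹ • x) (c⁻¹ • y)
      rw [dist_smul₀, norm_inv] at this
      have hcn : 0 < ‖c‖ := norm_pos_iff.2 hc0.ne'
      calc _ ≤ ‖c‖ * (M * (‖c‖⁻¹ * dist x y)) := by gcongr
        _ = _ := by field_simp
    -- On the sphere `‖x‖ = c * r` itself the inner formula applies, but both formulas give `x`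
    -- there because `c * r < b`.
    · have : ∀ x : E, c * r ≤ ‖x‖ → annularProd c r g (k + 1) x = g x := by
        intro x hx
        rcases hx.eq_or_lt with hx | hx
        · rw [annularProd_succ_of_le k hx.ge, hg x (Or.inl (hx ▸ hcr)),
            annularProd_of_ge hc hr hg k, smul_inv_smul₀ hc0.ne']
          rw [norm_inv_smul_eq hc0, ← hx]
          exact (mul_div_cancel_left₀ r hc0.ne').ge
        · exact annularProd_succ_of_lt k hx
      intro x y hx hy
      rw [this x hx, this y hy]
      exact hM x y

open Classical in
/-- The composition of all the conjugates of `g` under the powers of multiplication by `c`. -/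
noncomputable def annularInfProd (c r : ℝ) (g : E → E) (y : E) : E :=
  if h : ∃ k : ℕ, c ^ k * r < ‖y‖ then annularProd c r g (Nat.find h) y else y

theorem annularInfProd_eq (hc0 : 0 < c) (hc : c < 1) (hr : 0 < r)
    (hg : ∀ y, ‖y‖ < b ∨ r ≤ ‖y‖ → g y = y) {k : ℕ} {y : E}
    (hy : c ^ k * r < ‖y‖) : annularInfProd c r g y = annularProd c r g k y := by
  classical
  have h : ∃ k : ℕ, c ^ k * r < ‖y‖ := ⟨k, hy⟩
  rw [annularInfProd, dif_pos h]
  exact (annularProd_eq_of_le hc0 hr hg hc (Nat.find_min' h hy) (Nat.find_spec h)).symm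

theorem exists_pow_mul_lt (hc : c < 1) (hr : 0 < r) {t : ℝ} (ht : 0 < t) :
    ∃ k : ℕ, c ^ k * r < t := by
  obtain ⟨k, hk⟩ := exists_pow_lt_of_lt_one (div_pos ht hr) hc
  exact ⟨k, (lt_div_iff₀ hr).1 hk⟩

theorem annularInfProd_zero (hc0 : 0 < c) (hr : 0 < r) : annularInfProd c r g 0 = 0 := by
  rw [annularInfProd, dif_neg]
  rintro ⟨k, hk⟩
  rw [norm_zero] at hk
  exact absurd hk (not_lt.2 (by positivity))

theorem annularInfProd_of_ge (hc0 : 0 < c) (hc : c < 1) (hr : 0 < r)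
    (hg : ∀ y, ‖y‖ < b ∨ r ≤ ‖y‖ → g y = y) {y : E} (hy : r ≤ ‖y‖) :
    annularInfProd c r g y = y := by
  have : c ^ 1 * r < ‖y‖ := by nlinarith
  rw [annularInfProd_eq hc0 hc hr hg this, annularProd_of_ge hc hr hg 1 hy]

theorem annularInfProd_of_lt (hc0 : 0 < c) (hc : c < 1) (hr : 0 < r)
    (hg : ∀ y, ‖y‖ < b ∨ r ≤ ‖y‖ → g y = y) {y : E} (hy : c * r < ‖y‖) :
    annularInfProd c r g y = g y := by
  have : c ^ 1 * r < ‖y‖ := by rwa [pow_one]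
  rw [annularInfProd_eq hc0 hc hr hg this, annularProd_succ_of_lt 0 hy]

theorem annularInfProd_smul (hc0 : 0 < c) (hc : c < 1) (hr : 0 < r)
    (hg : ∀ y, ‖y‖ < b ∨ r ≤ ‖y‖ → g y = y) {y : E} (hy : ‖y‖ < b) :
    annularInfProd c r g y = c • annularInfProd c r g (c⁻¹ • y) := by
  rcases eq_or_ne y 0 with rfl | h0
  · simp [annularInfProd_zero hc0 hr]
  obtain ⟨k, hk⟩ := exists_pow_mul_lt hc hr (norm_pos_iff.2 h0)
  have hk' : c ^ (k + 1) * r < ‖y‖ := by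
    rw [pow_succ']; nlinarith [pow_pos hc0 k, mul_pos (pow_pos hc0 k) hr]
  have h2 : c ^ k * r < ‖c⁻¹ • y‖ := by
    rw [lt_norm_inv_smul hc0]; rwa [pow_succ', mul_assoc] at hk'
  rw [annularInfProd_eq hc0 hc hr hg hk', annularInfProd_eq hc0 hc hr hg h2,
    annularProd_succ_of_lt' hc0 hc hr hg k hy]

theorem norm_annularInfProd_le_iff (hc0 : 0 < c) (hc : c < 1) (hr : 0 < r)
    (hg : ∀ y, ‖y‖ < b ∨ r ≤ ‖y‖ → g y = y)
    (h₁ : ∀ y, ‖g y‖ ≤ c * r ↔ ‖y‖ ≤ c * r) (h₂ : ∀ y, ‖g y‖ ≤ r ↔ ‖y‖ ≤ r) (j : ℕ) (y : E) :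
    ‖annularInfProd c r g y‖ ≤ c ^ j * r ↔ ‖y‖ ≤ c ^ j * r := by
  rcases eq_or_ne y 0 with rfl | h0
  · rw [annularInfProd_zero hc0 hr]
  obtain ⟨k, hk⟩ := exists_pow_mul_lt hc hr (norm_pos_iff.2 h0)
  rw [annularInfProd_eq hc0 hc hr hg hk]
  exact norm_annularProd_le_iff hc0 hc hr h₁ h₂ k j y

/-- The product preserves each shell `c ^ (k + 1) * r < ‖y‖ ≤ c ^ k * r`, whose radii have ratio
`c⁻¹`. This controls the map at the origin, where the copies accumulate. -/
theorem norm_annularInfProd_le_and_ge (hc0 : 0 < c) (hc : c < 1) (hr : 0 < r)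
    (hg : ∀ y, ‖y‖ < b ∨ r ≤ ‖y‖ → g y = y)
    (h₁ : ∀ y, ‖g y‖ ≤ c * r ↔ ‖y‖ ≤ c * r) (h₂ : ∀ y, ‖g y‖ ≤ r ↔ ‖y‖ ≤ r) (y : E) :
    ‖annularInfProd c r g y‖ ≤ c⁻¹ * ‖y‖ ∧ ‖y‖ ≤ c⁻¹ * ‖annularInfProd c r g y‖ := by
  have hone : 1 ≤ c⁻¹ := (one_le_inv₀ hc0).2 hc.le
  rcases eq_or_ne y 0 with rfl | h0
  · simp [annularInfProd_zero hc0 hr]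
  rcases le_or_gt r ‖y‖ with h | h
  · rw [annularInfProd_of_ge hc0 hc hr hg h]
    have := le_mul_of_one_le_left (norm_nonneg y) hone
    exact ⟨this, this⟩
  classical
  have hex := exists_pow_mul_lt hc hr (norm_pos_iff.2 h0)
  obtain ⟨k, hk⟩ : ∃ k, Nat.find hex = k + 1 := by
    refine Nat.exists_eq_succ_of_ne_zero fun h2 => ?_
    have := Nat.find_spec hex
    rw [h2, pow_zero, one_mul] at this
    linarith
  have hl : c ^ (k + 1) * r < ‖y‖ := hk ▸ Nat.find_spec hex
  have hu : ‖y‖ ≤ c ^ k * r := not_lt.1 (Nat.find_min hex (by omega))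
  have hu' := (norm_annularInfProd_le_iff hc0 hc hr hg h₁ h₂ k y).2 hu
  have hl' : c ^ (k + 1) * r < ‖annularInfProd c r g y‖ := by
    rw [← not_le, norm_annularInfProd_le_iff hc0 hc hr hg h₁ h₂, not_le]; exact hl
  rw [pow_succ', mul_assoc] at hl hl'
  rw [inv_mul_eq_div, inv_mul_eq_div, le_div_iff₀ hc0, le_div_iff₀ hc0]
  constructor <;> nlinarith

theorem annularInfProd_leftInverse {g' : E → E} (hc0 : 0 < c) (hc : c < 1) (hr : 0 < r)
    (hg : ∀ y, ‖y‖ < b ∨ r ≤ ‖y‖ → g y = y) (hg' : ∀ y, ‖y‖ < b ∨ r ≤ ‖y‖ → g' y = y)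
    (h₁ : ∀ y, ‖g y‖ ≤ c * r ↔ ‖y‖ ≤ c * r) (h₂ : ∀ y, ‖g y‖ ≤ r ↔ ‖y‖ ≤ r)
    (h : ∀ y, g' (g y) = y) (y : E) :
    annularInfProd c r g' (annularInfProd c r g y) = y := by
  rcases eq_or_ne y 0 with rfl | h0
  · rw [annularInfProd_zero hc0 hr, annularInfProd_zero hc0 hr]
  obtain ⟨k, hk⟩ := exists_pow_mul_lt hc hr (norm_pos_iff.2 h0)
  have hk' : c ^ k * r < ‖annularInfProd c r g y‖ := by
    rw [← not_le, norm_annularInfProd_le_iff hc0 hc hr hg h₁ h₂, not_le]; exact hk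
  rw [annularInfProd_eq hc0 hc hr hg' hk', annularInfProd_eq hc0 hc hr hg hk,
    annularProd_leftInverse hc0 hc hr h₁ h₂ h]

/-- Two given points are both computed by one finite stage, and the bound for finite stages is
uniform. -/
theorem dist_annularInfProd_le {M : ℝ} (hM1 : 1 ≤ M) (hc0 : 0 < c) (hc : c < 1) (hr : 0 < r)
    (hcr : c * r < b) (hg : ∀ y, ‖y‖ < b ∨ r ≤ ‖y‖ → g y = y)
    (h₁ : ∀ y, ‖g y‖ ≤ c * r ↔ ‖y‖ ≤ c * r) (h₂ : ∀ y, ‖g y‖ ≤ r ↔ ‖y‖ ≤ r)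
    (hM : ∀ x y, dist (g x) (g y) ≤ M * dist x y) (x y : E) :
    dist (annularInfProd c r g x) (annularInfProd c r g y) ≤ M * dist x y := by
  have fix : ∀ k, annularProd c r g k (0 : E) = 0 := by
    intro k
    by_contra h0
    obtain ⟨j, hj⟩ := exists_pow_mul_lt hc hr (norm_pos_iff.2 h0)
    rw [← not_le, norm_annularProd_le_iff hc0 hc hr h₁ h₂, norm_zero] at hj
    exact hj (by positivity)
  have ev : ∀ z : E, ∃ k₀ : ℕ, ∀ k ≥ k₀, annularInfProd c r g z = annularProd c r g k z := by
    intro z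
    rcases eq_or_ne z 0 with rfl | h0
    · exact ⟨0, fun k _ => by rw [annularInfProd_zero hc0 hr, fix]⟩
    obtain ⟨k, hk⟩ := exists_pow_mul_lt hc hr (norm_pos_iff.2 h0)
    exact ⟨k, fun l hl => by
      rw [annularInfProd_eq hc0 hc hr hg hk, annularProd_eq_of_le hc0 hr hg hc hl hk]⟩
  obtain ⟨k, hk⟩ := ev x
  obtain ⟨l, hl⟩ := ev y
  rw [hk (max k l) (le_max_left _ _), hl (max k l) (le_max_right _ _)]
  exact dist_annularProd_le hM1 hc0 hc hr hcr hg hM _ x y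

/-- An induction principle on annuli. -/
theorem of_annulus {p : E → Prop} (hc0 : 0 < c) (hc : c < 1) (hr : 0 < r)
    (h : ∀ y, c * r < ‖y‖ → p y) (hs : ∀ y, ‖y‖ ≤ c * r → p (c⁻¹ • y) → p y) {y : E}
    (hy : y ≠ 0) : p y := by
  have key : ∀ (k : ℕ) (y : E), c ^ k * (c * r) < ‖y‖ → p y := by
    intro k
    induction k with
    | zero => intro y hy; exact h y (by simpa using hy)
    | succ k ih =>
      intro y hy
      rcases le_or_gt ‖y‖ (c * r) with h' | h'
      · refine hs y h' (ih _ ?_)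
        rw [lt_norm_inv_smul hc0, ← mul_assoc, ← pow_succ']
        exact hy
      · exact h y h'
  obtain ⟨k, hk⟩ := exists_pow_mul_lt hc (mul_pos hc0 hr) (norm_pos_iff.2 hy)
  exact key k y hk

/-- At the origin the shell estimate squeezes; elsewhere continuity spreads inward from the outer
annulus by self-similarity. -/
theorem continuous_annularInfProd (hc0 : 0 < c) (hc : c < 1) (hr : 0 < r)
    (hcr : c * r < b) (hg : ∀ y, ‖y‖ < b ∨ r ≤ ‖y‖ → g y = y)
    (h₁ : ∀ y, ‖g y‖ ≤ c * r ↔ ‖y‖ ≤ c * r) (h₂ : ∀ y, ‖g y‖ ≤ r ↔ ‖y‖ ≤ r)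
    (hcont : Continuous g) : Continuous (annularInfProd c r g) := by
  rw [continuous_iff_continuousAt]
  intro y
  rcases eq_or_ne y 0 with rfl | h0
  · rw [ContinuousAt, annularInfProd_zero hc0 hr]
    refine squeeze_zero_norm
      (fun z => (norm_annularInfProd_le_and_ge hc0 hc hr hg h₁ h₂ z).1) ?_
    have : Continuous fun z : E => c⁻¹ * ‖z‖ := by fun_prop
    simpa using this.tendsto 0
  refine of_annulus (p := fun y => ContinuousAt (annularInfProd c r g) y) hc0 hc hr ?_ ?_ h0
  · intro y hy
    refine hcont.continuousAt.congr ?_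
    filter_upwards [(isOpen_lt continuous_const continuous_norm).mem_nhds hy] with z hz
    exact (annularInfProd_of_lt hc0 hc hr hg hz).symm
  · intro y hy ih
    have : ContinuousAt (fun z => c • annularInfProd c r g (c⁻¹ • z)) y :=
      (ContinuousAt.comp (f := fun z => c⁻¹ • z) ih
        (continuous_const_smul c⁻¹).continuousAt).const_smul c
    refine this.congr ?_
    filter_upwards [(isOpen_lt continuous_norm continuous_const).mem_nhds (hy.trans_lt hcr)]
      with z hz
    exact (annularInfProd_smul hc0 hc hr hg hz).symm

end Function

/-- The infinite product of the conjugates of a homeomorphism `g`, supported on an annulus, under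
the powers of multiplication by `c`. -/
theorem exists_swindle (hc0 : 0 < c) (hc : c < 1) (hr : 0 < r) (hcr : c * r < b) (g : E ≃ₜ E)
    (hg : ∀ y, ‖y‖ < b ∨ r ≤ ‖y‖ → g y = y) :
    ∃ F : E ≃ₜ E, (∀ y, r ≤ ‖y‖ → F y = y) ∧ (∀ y, c * r < ‖y‖ → F y = g y) ∧
      (∀ y, ‖y‖ < b → F y = c • F (c⁻¹ • y)) ∧
      (∀ y, ‖F y‖ ≤ c⁻¹ * ‖y‖ ∧ ‖y‖ ≤ c⁻¹ * ‖F y‖) ∧ (∀ y, ‖F y‖ ≤ r ↔ ‖y‖ ≤ r) ∧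
      (∀ M, 1 ≤ M → (∀ x y, dist (g x) (g y) ≤ M * dist x y) →
        ∀ x y, dist (F x) (F y) ≤ M * dist x y) ∧
      ∀ M, 1 ≤ M → (∀ x y, dist (g.symm x) (g.symm y) ≤ M * dist x y) →
        ∀ x y, dist (F.symm x) (F.symm y) ≤ M * dist x y := by
  have hg' : ∀ y, ‖y‖ < b ∨ r ≤ ‖y‖ → g.symm y = y := fun y hy =>
    g.injective (by rw [g.apply_symm_apply, hg y hy])
  have s₁ : {y : E | ‖y‖ ≤ c * r} ⊆ {y : E | ‖y‖ < b ∨ r ≤ ‖y‖} :=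
    fun y hy => Or.inl (lt_of_le_of_lt hy hcr)
  have s₂ : {y : E | r < ‖y‖} ⊆ {y : E | ‖y‖ < b ∨ r ≤ ‖y‖} :=
    fun y hy => Or.inr (le_of_lt hy)
  have h₁ := norm_le_iff_of_fixed (Or.inl s₁) hg
  have h₂ := norm_le_iff_of_fixed (Or.inr s₂) hg
  have h₁' := norm_le_iff_of_fixed (Or.inl s₁) hg'
  have h₂' := norm_le_iff_of_fixed (Or.inr s₂) hg'
  refine ⟨⟨⟨annularInfProd c r g, annularInfProd c r g.symm,
    annularInfProd_leftInverse hc0 hc hr hg hg' h₁ h₂ g.symm_apply_apply,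
    annularInfProd_leftInverse hc0 hc hr hg' hg h₁' h₂' g.apply_symm_apply⟩,
    continuous_annularInfProd hc0 hc hr hcr hg h₁ h₂ g.continuous,
    continuous_annularInfProd hc0 hc hr hcr hg' h₁' h₂' g.symm.continuous⟩,
    fun y => annularInfProd_of_ge hc0 hc hr hg, fun y => annularInfProd_of_lt hc0 hc hr hg,
    fun y => annularInfProd_smul hc0 hc hr hg,
    norm_annularInfProd_le_and_ge hc0 hc hr hg h₁ h₂,
    fun y => by simpa using norm_annularInfProd_le_iff hc0 hc hr hg h₁ h₂ 0 y,
    fun M hM1 hM => dist_annularInfProd_le hM1 hc0 hc hr hcr hg h₁ h₂ hM,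
    fun M hM1 hM => dist_annularInfProd_le hM1 hc0 hc hr hcr hg' h₁' h₂' hM⟩

/-- Every homeomorphism supported on an annulus is a commutator. -/
theorem swindle_commutes {g F φ : E ≃ₜ E} (hc0 : 0 < c) (hcr : c * r < b)
    (hg : ∀ y, ‖y‖ < b ∨ r ≤ ‖y‖ → g y = y)
    (hF₁ : ∀ y, r ≤ ‖y‖ → F y = y) (hF₂ : ∀ y, c * r < ‖y‖ → F y = g y)
    (hF₃ : ∀ y, ‖y‖ < b → F y = c • F (c⁻¹ • y)) (hF₄ : ∀ y, ‖F y‖ ≤ r ↔ ‖y‖ ≤ r)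
    (hφ₁ : ∀ y, ‖y‖ ≤ r → φ y = c • y) (hφ₂ : ∀ y, r < ‖y‖ → c * r < ‖φ y‖) (y : E) :
    g (φ (F y)) = F (φ y) := by
  have hns : ∀ x : E, ‖x‖ ≤ r → ‖c • x‖ < b := fun x hx => by
    rw [norm_smul, Real.norm_of_nonneg hc0.le]
    nlinarith
  -- Inside radius `r`, `φ` is the dilation: `c • F y` lies where `g` is trivial, and
  -- self-similarity gives `F (c • y) = c • F y`. Outside, `F` fixes `y`, and `φ y` lies where `F`
  -- agrees with `g`.
  rcases le_or_gt ‖y‖ r with hy | hy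
  · rw [hφ₁ y hy, hφ₁ _ ((hF₄ y).2 hy), hg _ (Or.inl (hns _ ((hF₄ y).2 hy))),
      hF₃ _ (hns y hy), inv_smul_smul₀ hc0.ne']
  · rw [hF₁ y hy.le, hF₂ _ (hφ₂ y hy)]

end Swindle

/-! ### Stereographic coordinates and the chordal distance. -/

section Stereographic

variable {n : ℕ}

instance fact_finrank_euclideanSpace :
    Fact (Module.finrank ℝ (EuclideanSpace ℝ (Fin (n + 1))) = n + 1) :=
  ⟨finrank_euclideanSpace_fin⟩

/-- The value of the stereographic projection from `q` in coordinates centred at `p`. -/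
noncomputable def stereo (q : Sph n) (p : EuclideanSpace ℝ (Fin n)) (x : Sph n) :
    EuclideanSpace ℝ (Fin n) :=
  stereographic' n q x - p

/-- The inverse of the stereographic projection from `q` in coordinates centred at `p`. -/
noncomputable def stereoInv (q : Sph n) (p y : EuclideanSpace ℝ (Fin n)) : Sph n :=
  (stereographic' n q).symm (y + p)

variable {q : Sph n} {p : EuclideanSpace ℝ (Fin n)}

theorem stereoInv_ne (y : EuclideanSpace ℝ (Fin n)) : stereoInv q p y ≠ q := by
  have := (stereographic' n q).map_target (x := y + p) (by simp)
  simpa [stereoInv] using this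

theorem stereo_stereoInv (y : EuclideanSpace ℝ (Fin n)) : stereo q p (stereoInv q p y) = y := by
  rw [stereo, stereoInv, (stereographic' n q).right_inv (by simp), add_sub_cancel_right]

theorem stereoInv_stereo {x : Sph n} (hx : x ≠ q) : stereoInv q p (stereo q p x) = x := by
  rw [stereo, stereoInv, sub_add_cancel, (stereographic' n q).left_inv (by simpa using hx)]

theorem stereo_inj {x y : Sph n} (hx : x ≠ q) (hy : y ≠ q)
    (h : stereo q p x = stereo q p y) : x = y := by
  rw [← stereoInv_stereo (p := p) hx, h, stereoInv_stereo hy]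

theorem continuousOn_stereo : ContinuousOn (stereo q p) {q}ᶜ := by
  have := (stereographic' n q).continuousOn
  rw [stereographic'_source] at this
  exact this.sub continuousOn_const

theorem continuousAt_stereo {x : Sph n} (hx : x ≠ q) : ContinuousAt (stereo q p) x :=
  continuousOn_stereo.continuousAt (isOpen_compl_singleton.mem_nhds hx)

theorem continuous_stereoInv : Continuous (stereoInv q p) := by
  have := (stereographic' n q).continuousOn_symm
  rw [stereographic'_target, continuousOn_univ] at this
  exact this.comp (continuous_add_const p)

/-- The classical conformality formula, squared to avoid roots: expand with `stereoToFun v x = 2 /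
(1 - a) • (x - a • v)`, where `a` is the inner product of `v` and `x`. -/
theorem norm_stereoToFun_sub_sq_mul {F : Type*} [NormedAddCommGroup F]
    [InnerProductSpace ℝ F] {v x y : F} (hv : ‖v‖ = 1) (hx : ‖x‖ = 1) (hy : ‖y‖ = 1)
    (hxv : x ≠ v) (hyv : y ≠ v) :
    ‖stereoToFun v x - stereoToFun v y‖ ^ 2 * (‖x - v‖ ^ 2 * ‖y - v‖ ^ 2) =
      16 * ‖x - y‖ ^ 2 := by
  have hproj : ∀ z : F, (((ℝ ∙ v)ᗮ.orthogonalProjectionOnto z : (ℝ ∙ v)ᗮ) : F) =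
      z - inner ℝ v z • v := by
    intro z
    have := (ℝ ∙ v).starProjection_add_starProjection_orthogonal z
    rw [Submodule.starProjection_unit_singleton ℝ hv z] at this
    rw [← Submodule.starProjection_apply, eq_sub_iff_add_eq, add_comm, this]
  set a : ℝ := inner ℝ v x with ha
  set b : ℝ := inner ℝ v y with hb
  set s : ℝ := inner ℝ x y with hs
  have ha1 : a < 1 := (inner_lt_one_iff_real_of_norm_eq_one hv hx).2 hxv.symm
  have hb1 : b < 1 := (inner_lt_one_iff_real_of_norm_eq_one hv hy).2 hyv.symm
  have e1 : ‖stereoToFun v x - stereoToFun v y‖ =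
      ‖(2 / (1 - a)) • (x - a • v) - (2 / (1 - b)) • (y - b • v)‖ := by
    rw [← Submodule.norm_coe]
    simp only [stereoToFun_apply, Submodule.coe_sub, Submodule.coe_smul, hproj,
      innerSL_apply_apply]
    rfl
  have hvv : inner ℝ v v = (1 : ℝ) := by rw [real_inner_self_eq_norm_sq, hv]; norm_num
  have hxx : inner ℝ x x = (1 : ℝ) := by rw [real_inner_self_eq_norm_sq, hx]; norm_num
  have hyy : inner ℝ y y = (1 : ℝ) := by rw [real_inner_self_eq_norm_sq, hy]; norm_num
  have hxv' : inner ℝ x v = a := real_inner_comm _ _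
  have hyv' : inner ℝ y v = b := real_inner_comm _ _
  have hyx' : inner ℝ y x = s := real_inner_comm _ _
  have h1 : 1 - a ≠ 0 := by linarith
  have h2 : 1 - b ≠ 0 := by linarith
  rw [e1]
  simp only [← real_inner_self_eq_norm_sq, inner_sub_left, inner_sub_right, inner_smul_left,
    inner_smul_right, hvv, hxx, hyy, hxv', hyv', hyx', ← ha, ← hb, ← hs, conj_trivial]
  field_simp
  ring

theorem dist_stereo {x y : Sph n} (hx : x ≠ q) (hy : y ≠ q) :
    dist (stereo q p x) (stereo q p y) = 4 * dist x y / (dist x q * dist y q) := by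
  have hx' : 0 < dist x q := dist_pos.2 hx
  have hy' : 0 < dist y q := dist_pos.2 hy
  have hn : ∀ z : Sph n, ‖(z : EuclideanSpace ℝ (Fin (n + 1)))‖ = 1 := fun z =>
    norm_eq_of_mem_sphere z
  have h := norm_stereoToFun_sub_sq_mul (hn q) (hn x) (hn y)
    (fun h => hx (Subtype.ext h)) (fun h => hy (Subtype.ext h))
  have e : dist (stereo q p x) (stereo q p y) = ‖stereoToFun (q : EuclideanSpace ℝ (Fin (n + 1))) x -
      stereoToFun (q : EuclideanSpace ℝ (Fin (n + 1))) y‖ := by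
    rw [stereo, stereo, dist_sub_right, ← dist_eq_norm]
    exact ((OrthonormalBasis.fromOrthogonalSpanSingleton n
      (ne_zero_of_mem_unit_sphere q)).repr.dist_map _ _).trans (dist_eq_norm _ _)
  rw [← e, ← dist_eq_norm, ← dist_eq_norm, ← dist_eq_norm, ← Subtype.dist_eq, ← Subtype.dist_eq,
    ← Subtype.dist_eq] at h
  rw [eq_div_iff (by positivity), ← sq_eq_sq₀ (by positivity) (by positivity)]
  linear_combination h

theorem dist_eq_stereo {x y : Sph n} (hx : x ≠ q) (hy : y ≠ q) :
    dist x y = dist (stereo q p x) (stereo q p y) * (dist x q * dist y q) / 4 := by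
  have hx' : 0 < dist x q := dist_pos.2 hx
  have hy' : 0 < dist y q := dist_pos.2 hy
  rw [dist_stereo hx hy]
  field_simp

theorem dist_le_two (x y : Sph n) : dist x y ≤ 2 := by
  rw [Subtype.dist_eq, dist_eq_norm]
  refine (norm_sub_le _ _).trans ?_
  rw [norm_eq_of_mem_sphere x, norm_eq_of_mem_sphere y]
  norm_num

theorem exists_norm_stereo_le (q : Sph n) (p : EuclideanSpace ℝ (Fin n)) {δ : ℝ} (hδ : 0 < δ) :
    ∃ R, ∀ x, δ ≤ dist x q → ‖stereo q p x‖ ≤ R := by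
  have hd := dist_pos.2 (stereoInv_ne (q := q) (p := p) 0)
  set o := stereoInv q p 0
  refine ⟨4 * 2 / (δ * dist o q), fun x hx => ?_⟩
  have h := dist_stereo (p := p) (dist_pos.1 (hδ.trans_le hx)) (stereoInv_ne (q := q) (p := p) 0)
  rw [stereo_stereoInv, dist_zero_right] at h
  rw [h]
  have := dist_le_two x o
  gcongr

theorem exists_lt_norm_stereo (q : Sph n) (p : EuclideanSpace ℝ (Fin n)) (R : ℝ) :
    ∃ δ > 0, ∀ x, x ≠ q → dist x q < δ → R < ‖stereo q p x‖ := by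
  have hd := dist_pos.2 (stereoInv_ne (q := q) (p := p) 0)
  set o := stereoInv q p 0
  refine ⟨min (dist o q / 2) (2 / (|R| + 1)), by positivity, fun x hx hxδ => ?_⟩
  have hx0 := dist_pos.2 hx
  have h := dist_stereo (p := p) hx (stereoInv_ne (q := q) (p := p) 0)
  rw [stereo_stereoInv, dist_zero_right] at h
  have h1 := hxδ.trans_le (min_le_left _ _)
  have h2 := hxδ.trans_le (min_le_right _ _)
  have h3 : dist o q ≤ dist x o + dist x q := by
    rw [dist_comm x o]; exact dist_triangle _ _ _
  rw [h, lt_div_iff₀ (by positivity)]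
  rw [lt_div_iff₀ (by positivity)] at h2
  have h4 : R * dist x q < 2 := by
    have := le_abs_self R
    nlinarith
  nlinarith

end Stereographic

/-! ### Linear dilatation and its invariance under Möbius maps. -/

section Dilatation

variable {n : ℕ}

open Filter Topology

theorem linearDilatation_le_of_bounds {g : EuclideanSpace ℝ (Fin n) → EuclideanSpace ℝ (Fin n)}
    {x : EuclideanSpace ℝ (Fin n)} {α β : ℝ} (hβ : 0 < β)
    (h : ∀ᶠ y in 𝓝 x, β * dist y x ≤ dist (g x) (g y) ∧ dist (g x) (g y) ≤ α * dist y x) :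
    linearDilatation g x ≤ ENNReal.ofReal (α / β) := by
  obtain ⟨η, hη, hball⟩ := Metric.eventually_nhds_iff.1 h
  refine limsup_le_of_le (by isBoundedDefault) ?_
  filter_upwards [Ioo_mem_nhdsGT hη] with ε hε
  have hs : ⨆ y ∈ Metric.sphere x ε, edist (g x) (g y) ≤ ENNReal.ofReal (α * ε) := by
    refine iSup₂_le fun y hy => ?_
    rw [Metric.mem_sphere] at hy
    rw [edist_dist, ← hy]
    exact ENNReal.ofReal_le_ofReal (hball (hy ▸ hε.2)).2
  have hi : ENNReal.ofReal (β * ε) ≤ ⨅ y ∈ Metric.sphere x ε, edist (g x) (g y) := by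
    refine le_iInf₂ fun y hy => ?_
    rw [Metric.mem_sphere] at hy
    rw [edist_dist, ← hy]
    exact ENNReal.ofReal_le_ofReal (hball (hy ▸ hε.2)).1
  refine (ENNReal.div_le_div hs hi).trans ?_
  rw [← ENNReal.ofReal_div_of_pos (mul_pos hβ hε.1), mul_div_mul_right _ _ hε.1.ne']

/-- The linear dilatation does not increase under composition with similarities. -/
theorem linearDilatation_le_of_similarity
    {g g' S : EuclideanSpace ℝ (Fin n) → EuclideanSpace ℝ (Fin n)}
    {x : EuclideanSpace ℝ (Fin n)} {c κ : ℝ} (hc : 0 < c) (hκ : 0 < κ)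
    (hS : Function.Surjective S) (hSd : ∀ a b, dist (S a) (S b) = c * dist a b)
    (h : ∀ᶠ y in 𝓝 x, dist (g' x) (g' y) = κ * dist (g (S x)) (g (S y))) :
    linearDilatation g' x ≤ linearDilatation g (S x) := by
  obtain ⟨η, hη, hball⟩ := Metric.eventually_nhds_iff.1 h
  set R : ℝ → ℝ≥0∞ := fun ε => (⨆ y ∈ Metric.sphere (S x) ε, edist (g (S x)) (g y)) /
      (⨅ y ∈ Metric.sphere (S x) ε, edist (g (S x)) (g y)) with hR
  have himage : ∀ ε, S '' Metric.sphere x ε = Metric.sphere (S x) (c * ε) := by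
    intro ε
    ext z
    simp only [Set.mem_image, Metric.mem_sphere]
    constructor
    · rintro ⟨y, hy, rfl⟩
      rw [hSd, hy]
    · intro hz
      obtain ⟨y, rfl⟩ := hS z
      rw [hSd] at hz
      exact ⟨y, mul_left_cancel₀ hc.ne' hz, rfl⟩
  have hκ0 : ENNReal.ofReal κ ≠ 0 := by simpa using hκ
  have hev : ∀ᶠ ε in 𝓝[>] (0 : ℝ), (⨆ y ∈ Metric.sphere x ε, edist (g' x) (g' y)) /
      (⨅ y ∈ Metric.sphere x ε, edist (g' x) (g' y)) = R (c * ε) := by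
    filter_upwards [Ioo_mem_nhdsGT hη] with ε hε
    have he : ∀ y ∈ Metric.sphere x ε,
        edist (g' x) (g' y) = ENNReal.ofReal κ * edist (g (S x)) (g (S y)) := by
      intro y hy
      rw [Metric.mem_sphere] at hy
      rw [edist_dist, edist_dist, hball (hy ▸ hε.2), ENNReal.ofReal_mul hκ.le]
    have hs : ⨆ y ∈ Metric.sphere x ε, edist (g' x) (g' y) =
        ENNReal.ofReal κ * ⨆ y ∈ Metric.sphere (S x) (c * ε), edist (g (S x)) (g y) := by
      rw [← himage, iSup_image, ENNReal.mul_iSup]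
      refine iSup_congr fun y => ?_
      rw [ENNReal.mul_iSup]
      exact iSup_congr fun hy => he y hy
    have hi : ⨅ y ∈ Metric.sphere x ε, edist (g' x) (g' y) =
        ENNReal.ofReal κ * ⨅ y ∈ Metric.sphere (S x) (c * ε), edist (g (S x)) (g y) := by
      rw [← himage, iInf_image, ENNReal.mul_iInf_of_ne hκ0 ENNReal.ofReal_ne_top]
      refine iInf_congr fun y => ?_
      rw [ENNReal.mul_iInf_of_ne hκ0 ENNReal.ofReal_ne_top]
      exact iInf_congr fun hy => he y hy
    rw [hs, hi, ENNReal.mul_div_mul_left _ _ hκ0 ENNReal.ofReal_ne_top]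
  have ht : Tendsto (fun ε : ℝ => c * ε) (𝓝[>] 0) (𝓝[>] 0) := by
    refine tendsto_nhdsWithin_iff.2 ⟨?_, ?_⟩
    · have : Tendsto (fun ε : ℝ => c * ε) (𝓝 0) (𝓝 (c * 0)) := tendsto_id.const_mul c
      rw [mul_zero] at this
      exact this.mono_left nhdsWithin_le_nhds
    · filter_upwards [self_mem_nhdsWithin] with ε hε
      exact mul_pos hc hε
  calc linearDilatation g' x = limsup (R ∘ fun ε => c * ε) (𝓝[>] 0) := limsup_congr hev
    _ = limsup R (map (fun ε => c * ε) (𝓝[>] 0)) := rfl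
    _ ≤ limsup R (𝓝[>] 0) := limsup_le_limsup_of_le ht

/-- All the chart representations of `f` have linear dilatation less than `K` at `x`. -/
def DilatationLT (K : ℝ≥0) (f : Sph n → Sph n) (x : Sph n) : Prop :=
  ∀ v w : Sph n, x ≠ v → f x ≠ w →
    linearDilatation (fun y => stereo w 0 (f (stereoInv v 0 y))) (stereo v 0 x) < K

theorem DilatationLT.mono {K K' : ℝ≥0} {f : Sph n → Sph n} {x : Sph n}
    (h : DilatationLT K f x) (hK : K ≤ K') : DilatationLT K' f x :=
  fun v w hv hw => (h v w hv hw).trans_le (by exact_mod_cast hK)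

theorem mem_atlas_iff {φ : OpenPartialHomeomorph (Sph n) (EuclideanSpace ℝ (Fin n))} :
    φ ∈ atlas (EuclideanSpace ℝ (Fin n)) (Sph n) ↔ ∃ v : Sph n, φ = stereographic' n v :=
  Iff.rfl

theorem stereo_zero (v : Sph n) : stereo v 0 = stereographic' n v := by
  ext1 x; simp [stereo]

theorem stereoInv_zero (v : Sph n) : stereoInv v 0 = (stereographic' n v).symm := by
  ext1 x; simp [stereoInv]

/-- The atlas consists precisely of the stereographic charts, so pairs of charts become pairs of
poles and the bound can be checked point by point on the sphere. -/
theorem isQuasiconformal_iff {f : Sph n ≃ₜ Sph n} :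
    IsQuasiconformal f ↔ ∃ K, ∀ x, DilatationLT K f x := by
  refine exists_congr fun K => ⟨fun hK x v w hv hw => ?_, fun hK φ hφ ψ hψ y hy => ?_⟩
  · have := hK (stereographic' n v) (mem_atlas_iff.2 ⟨v, rfl⟩) (stereographic' n w)
      (mem_atlas_iff.2 ⟨w, rfl⟩) (stereo v 0 x)
    rw [← stereo_zero, ← stereoInv_zero] at this
    refine this ⟨by simp, ?_⟩
    rw [stereoInv_stereo hv, stereographic'_source]
    exact hw
  · obtain ⟨v, rfl⟩ := mem_atlas_iff.1 hφ
    obtain ⟨w, rfl⟩ := mem_atlas_iff.1 hψ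
    have hy2 := hy.2
    rw [← stereoInv_zero, stereographic'_source] at hy2
    have := hK (stereoInv v 0 y) v w (stereoInv_ne y) hy2
    rw [stereo_stereoInv, stereo_zero, stereoInv_zero] at this
    exact this

/-- A map which distorts distances from `x` by a factor at most `A` has bounded dilatation. -/
theorem dilatationLT_of_bounds {f : Sph n → Sph n} {x : Sph n} {A : ℝ} (hA : 0 < A) {K : ℝ≥0}
    (hK : 16 * A ^ 2 < K)
    (h : ∀ᶠ z in 𝓝 x, dist (f z) (f x) ≤ A * dist z x ∧ dist z x ≤ A * dist (f z) (f x)) :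
    DilatationLT K f x := by
  intro v w hv hw
  have hd := dist_pos.2 hv
  have he := dist_pos.2 hw
  set d := dist x v
  set e := dist (f x) w
  have hcont : ContinuousAt f x := by
    rw [ContinuousAt, tendsto_iff_dist_tendsto_zero]
    have ht : Tendsto (fun z => A * dist z x) (𝓝 x) (𝓝 0) := by
      have : Continuous fun z : Sph n => A * dist z x := by fun_prop
      simpa using this.tendsto x
    exact squeeze_zero' (Eventually.of_forall fun _ => dist_nonneg) (h.mono fun z hz => hz.1) ht
  have ev₁ : ∀ᶠ z in 𝓝 x, d / 2 < dist z v ∧ dist z v < 2 * d := by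
    have : Tendsto (fun z => dist z v) (𝓝 x) (𝓝 d) := tendsto_id.dist tendsto_const_nhds
    exact (this.eventually_const_lt (by linarith)).and (this.eventually_lt_const (by linarith))
  have ev₂ : ∀ᶠ z in 𝓝 x, e / 2 < dist (f z) w ∧ dist (f z) w < 2 * e := by
    have : Tendsto (fun z => dist (f z) w) (𝓝 x) (𝓝 e) := hcont.dist tendsto_const_nhds
    exact (this.eventually_const_lt (by linarith)).and (this.eventually_lt_const (by linarith))
  have hinv : Tendsto (stereoInv v 0) (𝓝 (stereo v 0 x)) (𝓝 x) := by
    have := (continuous_stereoInv (q := v) (p := 0)).tendsto (stereo v 0 x)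
    rwa [stereoInv_stereo hv] at this
  -- Near `x` the distances to the poles vary by a factor at most 2, so the chart representation
  -- distorts distances by `d ^ 2 / e ^ 2` up to a factor `4 * A` each way. The quotient of the
  -- bounds is `16 * A ^ 2`.
  refine (linearDilatation_le_of_bounds (α := 4 * A * d ^ 2 / e ^ 2)
    (β := d ^ 2 / (4 * A * e ^ 2)) (by positivity) ?_).trans_lt ?_
  · filter_upwards [hinv.eventually h, hinv.eventually ev₁, hinv.eventually ev₂]
      with y ⟨h₁, h₂⟩ ⟨h₃, h₄⟩ ⟨h₅, h₆⟩
    have hzy : stereo v 0 (stereoInv v 0 y) = y := stereo_stereoInv y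
    set z := stereoInv v 0 y
    have hzv : z ≠ v := stereoInv_ne y
    have hzw : f z ≠ w := dist_pos.1 (lt_trans (by positivity) h₅)
    have hyx : dist y (stereo v 0 x) = 4 * dist z x / (dist z v * d) := by
      rw [← hzy]; exact dist_stereo hzv hv
    have hg : dist (stereo w 0 (f (stereoInv v 0 (stereo v 0 x)))) (stereo w 0 (f z)) =
        4 * dist (f z) (f x) / (dist (f z) w * e) := by
      rw [stereoInv_stereo hv, dist_comm]; exact dist_stereo hzw hw
    rw [hyx, hg]
    have p₁ : 0 < dist z v := by linarith
    have p₂ : 0 < dist (f z) w := by linarith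
    have n₁ : 0 ≤ dist z x := dist_nonneg
    have n₂ : 0 ≤ dist (f z) (f x) := dist_nonneg
    constructor
    · calc _ = d / (A * e ^ 2 * dist z v) * dist z x := by field_simp
        _ ≤ d / (A * e ^ 2 * (d / 2)) * (A * dist (f z) (f x)) := by gcongr
        _ = 4 * dist (f z) (f x) / (2 * e * e) := by field_simp; ring
        _ ≤ _ := by gcongr
    · calc _ ≤ 4 * (A * dist z x) / (e / 2 * e) := by gcongr
        _ = 16 * A * dist z x * d ^ 2 / (e ^ 2 * (2 * d * d)) := by field_simp; ring
        _ ≤ 16 * A * dist z x * d ^ 2 / (e ^ 2 * (dist z v * d)) := by gcongr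
        _ = _ := by field_simp; ring
  · have : 4 * A * d ^ 2 / e ^ 2 / (d ^ 2 / (4 * A * e ^ 2)) = 16 * A ^ 2 := by
      field_simp; norm_num
    rw [this]
    rw [ENNReal.ofReal_lt_coe_iff] <;> linarith [sq_nonneg A]

/-- A permutation of the sphere which is conformal in the sense that it multiplies chordal
distances by `m x * m y` for a positive function `m`. -/
def IsMobius (D : Equiv.Perm (Sph n)) : Prop :=
  ∃ m : Sph n → ℝ, (∀ x, 0 < m x) ∧ ∀ x y, dist (D x) (D y) = m x * m y * dist x y

/-- In the charts with poles `v` and `D v` the factors at `x` and `y` cancel, so `D` becomes a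
similarity. -/
theorem dist_stereo_mobius {D : Equiv.Perm (Sph n)} {m : Sph n → ℝ} (hm : ∀ x, 0 < m x)
    (hD : ∀ x y, dist (D x) (D y) = m x * m y * dist x y) {v x y : Sph n} (hx : x ≠ v)
    (hy : y ≠ v) :
    dist (stereo (D v) 0 (D x)) (stereo (D v) 0 (D y)) =
      (m v ^ 2)⁻¹ * dist (stereo v 0 x) (stereo v 0 y) := by
  rw [dist_stereo (D.injective.ne hx) (D.injective.ne hy), dist_stereo hx hy, hD, hD, hD]
  have := hm x
  have := hm y
  have := hm v
  have := dist_pos.2 hx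
  have := dist_pos.2 hy
  field_simp

/-- Conjugation by a Möbius transformation does not change the bound on the dilatation. -/
theorem DilatationLT.conj_mobius {K : ℝ≥0} {f f' : Sph n → Sph n} {D : Equiv.Perm (Sph n)}
    (hD : IsMobius D) {u : Sph n} (hf' : ContinuousAt f' (D u))
    (h : ∀ᶠ z in 𝓝 (D u), f' z = D (f (D.symm z))) (hf : DilatationLT K f u) :
    DilatationLT K f' (D u) := by
  obtain ⟨m, hm, hD⟩ := hD
  intro v w hv hw
  obtain ⟨v, rfl⟩ := D.surjective v
  obtain ⟨w, rfl⟩ := D.surjective w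
  have hu : f' (D u) = D (f u) := by rw [h.self_of_nhds, D.symm_apply_apply]
  have huv : u ≠ v := fun h => hv (h ▸ rfl)
  have huw : f u ≠ w := fun h => hw (by rw [hu, h])
  -- The chart form of `D⁻¹` from pole `D v` to pole `v`, a similarity of ratio `m v ^ 2`.
  set S : EuclideanSpace ℝ (Fin n) → EuclideanSpace ℝ (Fin n) :=
    fun y => stereo v 0 (D.symm (stereoInv (D v) 0 y)) with hS
  have hne : ∀ y, D.symm (stereoInv (D v) 0 y) ≠ v := fun y hy =>
    stereoInv_ne (q := D v) (p := 0) y (D.symm_apply_eq.1 hy)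
  have hSu : S (stereo (D v) 0 (D u)) = stereo v 0 u := by
    simp only [hS, stereoInv_stereo hv, D.symm_apply_apply]
  have hmv := hm v
  have hmw := hm w
  have hinv : Tendsto (stereoInv (D v) 0) (𝓝 (stereo (D v) 0 (D u))) (𝓝 (D u)) := by
    have := (continuous_stereoInv (q := D v) (p := 0)).tendsto (stereo (D v) 0 (D u))
    rwa [stereoInv_stereo hv] at this
  refine lt_of_le_of_lt ?_ (hf v w huv huw)
  rw [← hSu]
  refine linearDilatation_le_of_similarity (c := m v ^ 2) (κ := (m w ^ 2)⁻¹) (by positivity)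
    (by positivity) ?_ ?_ ?_
  · intro t
    refine ⟨stereo (D v) 0 (D (stereoInv v 0 t)), ?_⟩
    simp only [hS]
    rw [stereoInv_stereo (D.injective.ne (stereoInv_ne t)), D.symm_apply_apply, stereo_stereoInv]
  · intro a b
    have := dist_stereo_mobius hm hD (hne a) (hne b)
    rw [D.apply_symm_apply, D.apply_symm_apply, stereo_stereoInv, stereo_stereoInv] at this
    rw [this]
    field_simp
    rfl
  · filter_upwards [hinv.eventually h,
      hinv.eventually (hf'.eventually (isOpen_compl_singleton.mem_nhds hw))] with y hy hy'
    have e : stereoInv v 0 (S y) = D.symm (stereoInv (D v) 0 y) := stereoInv_stereo (hne y)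
    have hyw : f (D.symm (stereoInv (D v) 0 y)) ≠ w := fun hh => hy' (by
      rw [Set.mem_singleton_iff, hy, hh])
    rw [hSu, e, stereoInv_stereo huv, stereoInv_stereo hv, hu, hy]
    exact dist_stereo_mobius hm hD huw hyw

theorem DilatationLT.congr {K : ℝ≥0} {f f' : Sph n → Sph n} {x : Sph n}
    (hf : DilatationLT K f x) (hf' : ContinuousAt f' x) (h : f' =ᶠ[𝓝 x] f) :
    DilatationLT K f' x :=
  hf.conj_mobius (D := 1) ⟨fun _ => 1, fun _ => one_pos, fun x y => by simp⟩ hf' h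

end Dilatation

open Filter Topology

/-! ### Comparison of the spherical and chordal metrics. -/

section SphericalMetric

variable {n : ℕ}

theorem dist_eq_two_mul_sin (x y : Sph n) : dist x y = 2 * Real.sin (sphDist x y / 2) := by
  have h0 : 0 ≤ sphDist x y := InnerProductGeometry.angle_nonneg _ _
  have hpi : sphDist x y ≤ Real.pi := InnerProductGeometry.angle_le_pi _ _
  have hs : 0 ≤ Real.sin (sphDist x y / 2) :=
    Real.sin_nonneg_of_nonneg_of_le_pi (by linarith) (by linarith)
  rw [← sq_eq_sq₀ dist_nonneg (by positivity), mul_pow, Real.sin_sq_eq_half_sub,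
    mul_div_cancel₀ _ (two_ne_zero), sphDist, InnerProductGeometry.cos_angle,
    norm_eq_of_mem_sphere x, norm_eq_of_mem_sphere y, Subtype.dist_eq, dist_eq_norm,
    norm_sub_sq_real, norm_eq_of_mem_sphere x, norm_eq_of_mem_sphere y]
  ring

theorem dist_le_sphDist (x y : Sph n) : dist x y ≤ sphDist x y := by
  have h0 : 0 ≤ sphDist x y := InnerProductGeometry.angle_nonneg _ _
  rw [dist_eq_two_mul_sin]
  linarith [Real.sin_le (show 0 ≤ sphDist x y / 2 by linarith)]

/-- Jordan's inequality for the sine of half the angle. -/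
theorem sphDist_le_dist (x y : Sph n) : sphDist x y ≤ Real.pi / 2 * dist x y := by
  have h0 : 0 ≤ sphDist x y := InnerProductGeometry.angle_nonneg _ _
  have hpi : sphDist x y ≤ Real.pi := InnerProductGeometry.angle_le_pi _ _
  have h := Real.mul_le_sin (show 0 ≤ sphDist x y / 2 by linarith) (by linarith)
  rw [dist_eq_two_mul_sin]
  have hp := Real.pi_pos
  calc sphDist x y = Real.pi * (2 / Real.pi * (sphDist x y / 2)) := by field_simp
    _ ≤ Real.pi * Real.sin (sphDist x y / 2) := by gcongr
    _ = _ := by ring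

theorem isBilipschitz_iff {f : Sph n ≃ₜ Sph n} :
    IsBilipschitz f ↔ (∃ L : ℝ, ∀ x y, dist (f x) (f y) ≤ L * dist x y) ∧
      ∃ L : ℝ, ∀ x y, dist (f.symm x) (f.symm y) ≤ L * dist x y := by
  have hp := Real.pi_pos
  constructor
  · rintro ⟨L, hL, h⟩
    refine ⟨⟨L * (Real.pi / 2), fun x y => ?_⟩, ⟨L * (Real.pi / 2), fun x y => ?_⟩⟩
    · calc _ ≤ _ := dist_le_sphDist _ _
        _ ≤ L * sphDist x y := (h x y).1
        _ ≤ L * (Real.pi / 2 * dist x y) := by gcongr; exact sphDist_le_dist x y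
        _ = _ := by ring
    · have := (h (f.symm x) (f.symm y)).2
      rw [f.apply_symm_apply, f.apply_symm_apply, div_le_iff₀ hL] at this
      calc _ ≤ _ := dist_le_sphDist _ _
        _ ≤ _ := this
        _ ≤ Real.pi / 2 * dist x y * L := by gcongr; exact sphDist_le_dist x y
        _ = _ := by ring
  · rintro ⟨⟨L₁, h₁⟩, ⟨L₂, h₂⟩⟩
    have hM : 0 < max L₁ (max L₂ 1) := by positivity
    refine ⟨Real.pi / 2 * max L₁ (max L₂ 1), by positivity, fun x y => ⟨?_, ?_⟩⟩
    · calc _ ≤ _ := sphDist_le_dist _ _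
        _ ≤ Real.pi / 2 * (L₁ * dist x y) := by gcongr; exact h₁ x y
        _ ≤ Real.pi / 2 * (max L₁ (max L₂ 1) * sphDist x y) := by
          gcongr
          · exact le_max_left _ _
          · exact dist_le_sphDist x y
        _ = _ := by ring
    · have := h₂ (f x) (f y)
      rw [f.symm_apply_apply, f.symm_apply_apply] at this
      rw [div_le_iff₀ (by positivity)]
      calc _ ≤ _ := sphDist_le_dist _ _
        _ ≤ Real.pi / 2 * (L₂ * dist (f x) (f y)) := by gcongr
        _ ≤ Real.pi / 2 * (max L₁ (max L₂ 1) * sphDist (f x) (f y)) := by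
          gcongr
          · exact (le_max_left _ _).trans (le_max_right _ _)
          · exact dist_le_sphDist _ _
        _ = _ := by ring

theorem IsBilipschitz.isQuasiconformal {f : Sph n ≃ₜ Sph n} (hf : IsBilipschitz f) :
    IsQuasiconformal f := by
  obtain ⟨⟨L₁, h₁⟩, ⟨L₂, h₂⟩⟩ := isBilipschitz_iff.1 hf
  set A := max L₁ (max L₂ 1)
  have hA : 0 < A := by positivity
  refine isQuasiconformal_iff.2 ⟨(16 * A ^ 2 + 1).toNNReal, fun x =>
    dilatationLT_of_bounds hA ?_ (Eventually.of_forall fun z => ⟨?_, ?_⟩)⟩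
  · rw [Real.coe_toNNReal _ (by positivity)]; linarith
  · exact (h₁ z x).trans (by gcongr; exact le_max_left _ _)
  · have := h₂ (f z) (f x)
    rw [f.symm_apply_apply, f.symm_apply_apply] at this
    exact this.trans (by gcongr; exact (le_max_left _ _).trans (le_max_right _ _))

end SphericalMetric

/-! ### Passing between maps of the sphere fixing `q` and maps of `ℝⁿ`. -/

section Lift

variable {n : ℕ} {q : Sph n} {p : EuclideanSpace ℝ (Fin n)}

/-- `f` is the identity on the ball of chordal radius `δ` about `q`. -/
def FixesNear (q : Sph n) (δ : ℝ) (f : Sph n → Sph n) : Prop :=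
  ∀ x, dist x q < δ → f x = x

theorem FixesNear.symm {δ : ℝ} {f : Sph n ≃ₜ Sph n} (hf : FixesNear q δ f) :
    FixesNear q δ f.symm :=
  fun x hx => f.injective (by rw [f.apply_symm_apply, hf x hx])

theorem FixesNear.mono {δ δ' : ℝ} {f : Sph n → Sph n} (hf : FixesNear q δ f) (h : δ' ≤ δ) :
    FixesNear q δ' f :=
  fun x hx => hf x (hx.trans_le h)

/-- Away from `q` the trivial bound 2 on chordal distances suffices. This controls the weights `dist
x q` relating chordal to chart distances. -/
theorem FixesNear.dist_le {δ : ℝ} (hδ : 0 < δ) {f : Sph n ≃ₜ Sph n} (hf : FixesNear q δ f)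
    (x : Sph n) : dist (f x) q ≤ max 1 (2 / δ) * dist x q := by
  rcases lt_or_ge (dist x q) δ with h | h
  · rw [hf x h]
    exact le_mul_of_one_le_left dist_nonneg (le_max_left _ _)
  · calc _ ≤ 2 := dist_le_two _ _
      _ = 2 / δ * δ := by field_simp
      _ ≤ _ := by gcongr; exact le_max_right _ _

theorem FixesNear.dist_ge {δ : ℝ} (hδ : 0 < δ) {f : Sph n ≃ₜ Sph n} (hf : FixesNear q δ f)
    (x : Sph n) : dist x q ≤ max 1 (2 / δ) * dist (f x) q := by
  simpa using hf.symm.dist_le hδ (f x)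

/-- The map `f` of the sphere fixes `q` and is given by `h` in the stereographic chart. -/
def IsLift (q : Sph n) (p : EuclideanSpace ℝ (Fin n)) (f : Sph n → Sph n)
    (h : EuclideanSpace ℝ (Fin n) → EuclideanSpace ℝ (Fin n)) : Prop :=
  f q = q ∧ ∀ x, x ≠ q → f x ≠ q ∧ stereo q p (f x) = h (stereo q p x)

theorem IsLift.symm {f : Sph n ≃ₜ Sph n} {h : EuclideanSpace ℝ (Fin n) ≃ₜ EuclideanSpace ℝ (Fin n)}
    (hf : IsLift q p f h) : IsLift q p f.symm h.symm := by
  have h1 : f.symm q = q := by rw [f.symm_apply_eq, hf.1]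
  refine ⟨h1, fun x hx => ?_⟩
  have h2 : f.symm x ≠ q := fun h => hx (by rw [← f.apply_symm_apply x, h, hf.1])
  refine ⟨h2, ?_⟩
  rw [h.eq_symm_apply, ← (hf.2 _ h2).2, f.apply_symm_apply]

theorem IsLift.eq_of_eq {f f' : Sph n → Sph n}
    {h h' : EuclideanSpace ℝ (Fin n) → EuclideanSpace ℝ (Fin n)} (hf : IsLift q p f h)
    (hf' : IsLift q p f' h') {x : Sph n} (hx : x ≠ q)
    (e : h (stereo q p x) = h' (stereo q p x)) : f x = f' x :=
  stereo_inj (p := p) (hf.2 x hx).1 (hf'.2 x hx).1 (by rw [(hf.2 x hx).2, (hf'.2 x hx).2, e])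

theorem IsLift.comp {f f' : Sph n → Sph n}
    {h h' : EuclideanSpace ℝ (Fin n) → EuclideanSpace ℝ (Fin n)} (hf : IsLift q p f h)
    (hf' : IsLift q p f' h') : IsLift q p (f ∘ f') (h ∘ h') := by
  refine ⟨by simp [hf.1, hf'.1], fun x hx => ⟨(hf.2 _ (hf'.2 x hx).1).1, ?_⟩⟩
  simp only [Function.comp_apply, (hf.2 _ (hf'.2 x hx).1).2, (hf'.2 x hx).2]

theorem isLift_id : IsLift q p id id := ⟨rfl, fun _ hx => ⟨hx, rfl⟩⟩

theorem IsLift.fixesNear {f : Sph n → Sph n} {R : ℝ}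
    {h : EuclideanSpace ℝ (Fin n) → EuclideanSpace ℝ (Fin n)} (hf : IsLift q p f h)
    (hR : ∀ y, R ≤ ‖y‖ → h y = y) : ∃ δ > 0, FixesNear q δ f := by
  obtain ⟨δ, hδ, hδR⟩ := exists_lt_norm_stereo q p R
  refine ⟨δ, hδ, fun x hx => ?_⟩
  rcases eq_or_ne x q with rfl | hxq
  · exact hf.1
  · exact hf.eq_of_eq isLift_id hxq (hR _ (hδR x hxq hx).le)

open Classical in
/-- The permutation of the sphere fixing `q` given by `h` in the stereographic chart. -/
noncomputable def stereoLift (q : Sph n) (p : EuclideanSpace ℝ (Fin n))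
    (h : Equiv.Perm (EuclideanSpace ℝ (Fin n))) : Equiv.Perm (Sph n) where
  toFun x := if x = q then q else stereoInv q p (h (stereo q p x))
  invFun x := if x = q then q else stereoInv q p (h.symm (stereo q p x))
  left_inv x := by
    by_cases hx : x = q
    · simp [hx]
    · simp [hx, stereoInv_ne, stereo_stereoInv, stereoInv_stereo]
  right_inv x := by
    by_cases hx : x = q
    · simp [hx]
    · simp [hx, stereoInv_ne, stereo_stereoInv, stereoInv_stereo]

theorem isLift_stereoLift (h : Equiv.Perm (EuclideanSpace ℝ (Fin n))) :
    IsLift q p (stereoLift q p h) h := by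
  refine ⟨by simp [stereoLift], fun x hx => ?_⟩
  simp [stereoLift, hx, stereoInv_ne, stereo_stereoInv]

theorem continuous_stereoLift {R : ℝ} (h : EuclideanSpace ℝ (Fin n) ≃ₜ EuclideanSpace ℝ (Fin n))
    (hR : ∀ y, R ≤ ‖y‖ → h y = y) : Continuous (stereoLift q p h.toEquiv) := by
  have hl := isLift_stereoLift (q := q) (p := p) h.toEquiv
  rw [continuous_iff_continuousAt]
  intro x
  rcases eq_or_ne x q with rfl | hx
  · obtain ⟨δ, hδ, hf⟩ := hl.fixesNear hR
    refine continuousAt_id.congr ?_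
    filter_upwards [Metric.ball_mem_nhds x hδ] with z hz
    exact (hf z hz).symm
  · have : ContinuousAt (fun z => stereoInv q p (h (stereo q p z))) x :=
      continuous_stereoInv.continuousAt.comp (h.continuous.continuousAt.comp (continuousAt_stereo hx))
    refine this.congr ?_
    filter_upwards [isOpen_compl_singleton.mem_nhds hx] with z hz
    exact (if_neg hz).symm

theorem exists_isLift {R : ℝ} (h : EuclideanSpace ℝ (Fin n) ≃ₜ EuclideanSpace ℝ (Fin n))
    (hR : ∀ y, R ≤ ‖y‖ → h y = y) : ∃ f : Sph n ≃ₜ Sph n, IsLift q p f h :=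
  ⟨⟨stereoLift q p h.toEquiv, continuous_stereoLift h hR,
    continuous_stereoLift h.symm fun y hy => h.injective (by rw [h.apply_symm_apply, hR y hy])⟩,
    isLift_stereoLift h.toEquiv⟩

/-- A homeomorphism fixing `q` induces a homeomorphism of the Euclidean space. -/
theorem exists_isLift_of_fixed (p : EuclideanSpace ℝ (Fin n)) (f : Sph n ≃ₜ Sph n) (hf : f q = q) :
    ∃ h : EuclideanSpace ℝ (Fin n) ≃ₜ EuclideanSpace ℝ (Fin n), IsLift q p f h := by
  have hf' : f.symm q = q := by rw [f.symm_apply_eq, hf]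
  have key : ∀ f : Sph n ≃ₜ Sph n, f q = q → ∀ x, x ≠ q → f x ≠ q := fun f hf x hx h =>
    hx (f.injective (h.trans hf.symm))
  have hc : ∀ f : Sph n ≃ₜ Sph n, f q = q →
      Continuous fun y => stereo q p (f (stereoInv q p y)) := fun f hf =>
    continuousOn_stereo.comp_continuous (f.continuous.comp continuous_stereoInv) fun y =>
      key f hf _ (stereoInv_ne y)
  refine ⟨⟨⟨fun y => stereo q p (f (stereoInv q p y)), fun y => stereo q p (f.symm (stereoInv q p y)),
    fun y => ?_, fun y => ?_⟩, hc f hf, hc f.symm hf'⟩, hf, fun x hx => ⟨key f hf x hx, ?_⟩⟩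
  · simp only [stereoInv_stereo (key f hf _ (stereoInv_ne y)), f.symm_apply_apply,
      stereo_stereoInv]
  · simp only [stereoInv_stereo (key f.symm hf' _ (stereoInv_ne y)), f.apply_symm_apply,
      stereo_stereoInv]
  · change _ = stereo q p (f (stereoInv q p (stereo q p x)))
    rw [stereoInv_stereo hx]

theorem IsLift.eq_self_of_fixesNear {f : Sph n → Sph n} {δ : ℝ}
    {h : EuclideanSpace ℝ (Fin n) → EuclideanSpace ℝ (Fin n)} (hf : IsLift q p f h)
    (hδ : FixesNear q δ f) {y : EuclideanSpace ℝ (Fin n)}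
    (hy : dist (stereoInv q p y) q < δ) : h y = y := by
  have h1 := (hf.2 (stereoInv q p y) (stereoInv_ne y)).2
  rw [hδ _ hy, stereo_stereoInv] at h1
  exact h1.symm

theorem IsLift.dist_le {f : Sph n ≃ₜ Sph n} {δ M : ℝ} (hδ : 0 < δ)
    {h : EuclideanSpace ℝ (Fin n) → EuclideanSpace ℝ (Fin n)} (hf : IsLift q p f h)
    (hfix : FixesNear q δ f) (hM : ∀ x y, dist (h x) (h y) ≤ M * dist x y) :
    ∃ L : ℝ, ∀ x y, dist (f x) (f y) ≤ L * dist x y := by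
  set A := max 1 (2 / δ)
  have hA1 : 1 ≤ A := le_max_left _ _
  have hb : ∀ x, dist (f x) q ≤ A * dist x q := hfix.dist_le hδ
  refine ⟨max A (|M| * A ^ 2), fun x y => ?_⟩
  rcases eq_or_ne x q with rfl | hx
  · rw [hf.1, dist_comm, dist_comm x y]
    exact (hb y).trans (by gcongr; exact le_max_left _ _)
  rcases eq_or_ne y q with rfl | hy
  · rw [hf.1]
    exact (hb x).trans (by gcongr; exact le_max_left _ _)
  have h1 : dist (stereo q p (f x)) (stereo q p (f y)) ≤
      |M| * dist (stereo q p x) (stereo q p y) := by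
    rw [(hf.2 x hx).2, (hf.2 y hy).2]
    exact (hM _ _).trans (by gcongr; exact le_abs_self M)
  rw [dist_eq_stereo (p := p) (hf.2 x hx).1 (hf.2 y hy).1, dist_eq_stereo (p := p) hx hy]
  calc _ ≤ |M| * dist (stereo q p x) (stereo q p y) * ((A * dist x q) * (A * dist y q)) / 4 := by
        have := hb x
        have := hb y
        gcongr
    _ = |M| * A ^ 2 * (dist (stereo q p x) (stereo q p y) * (dist x q * dist y q) / 4) := by ring
    _ ≤ _ := by gcongr; exact le_max_right _ _

theorem IsLift.dist_le_of_dist_le {f : Sph n ≃ₜ Sph n} {δ L : ℝ} (hδ : 0 < δ)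
    {h : EuclideanSpace ℝ (Fin n) → EuclideanSpace ℝ (Fin n)} (hf : IsLift q p f h)
    (hfix : FixesNear q δ f) (hL : ∀ x y, dist (f x) (f y) ≤ L * dist x y) :
    ∃ M : ℝ, 1 ≤ M ∧ ∀ x y, dist (h x) (h y) ≤ M * dist x y := by
  set A := max 1 (2 / δ)
  have hA1 : 1 ≤ A := le_max_left _ _
  have hb : ∀ x, dist x q ≤ A * dist (f x) q := hfix.dist_ge hδ
  refine ⟨max 1 (|L| * A ^ 2), le_max_left _ _, fun x y => ?_⟩
  obtain ⟨x, hx, rfl⟩ : ∃ x', x' ≠ q ∧ stereo q p x' = x := ⟨_, stereoInv_ne x, stereo_stereoInv x⟩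
  obtain ⟨y, hy, rfl⟩ : ∃ y', y' ≠ q ∧ stereo q p y' = y := ⟨_, stereoInv_ne y, stereo_stereoInv y⟩
  rw [← (hf.2 x hx).2, ← (hf.2 y hy).2, dist_stereo (hf.2 x hx).1 (hf.2 y hy).1, dist_stereo hx hy]
  have hx0 := dist_pos.2 hx
  have hy0 := dist_pos.2 hy
  have hfx0 := dist_pos.2 (hf.2 x hx).1
  have hfy0 := dist_pos.2 (hf.2 y hy).1
  have h1 : dist (f x) (f y) ≤ |L| * dist x y :=
    (hL x y).trans (by gcongr; exact le_abs_self L)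
  have h2 : dist x q * dist y q ≤ A ^ 2 * (dist (f x) q * dist (f y) q) :=
    calc _ ≤ (A * dist (f x) q) * (A * dist (f y) q) := by
          have := hb x
          have := hb y
          gcongr
      _ = _ := by ring
  calc _ ≤ 4 * (|L| * dist x y) / (dist (f x) q * dist (f y) q) := by gcongr
    _ = 4 * (|L| * dist x y) * A ^ 2 / (A ^ 2 * (dist (f x) q * dist (f y) q)) := by field_simp
    _ ≤ 4 * (|L| * dist x y) * A ^ 2 / (dist x q * dist y q) := by gcongr
    _ = |L| * A ^ 2 * (4 * dist x y / (dist x q * dist y q)) := by ring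
    _ ≤ _ := by gcongr; exact le_max_right _ _

/-- Dilations in a stereographic chart are Möbius transformations. -/
theorem isMobius_stereoLift {c : ℝ} (hc : 0 < c) :
    IsMobius (stereoLift q p (Homeomorph.smulOfNeZero c hc.ne').toEquiv) := by
  classical
  set D := stereoLift q p (Homeomorph.smulOfNeZero c hc.ne').toEquiv
  have hD : IsLift q p D fun y => c • y := isLift_stereoLift _
  have hs : 0 < √c := Real.sqrt_pos.2 hc
  have hss : √c * √c = c := Real.mul_self_sqrt hc.le
  -- The value off `q` is read off from `dist_stereo`; the value at `q` is then forced by the pairs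
  -- `(q, y)`.
  refine ⟨fun x => if x = q then (√c)⁻¹ else √c * dist (D x) q / dist x q, fun x => ?_,
    fun x y => ?_⟩
  · dsimp only
    split_ifs with hx
    · positivity
    · have := dist_pos.2 hx
      have := dist_pos.2 (hD.2 x hx).1
      positivity
  · by_cases hx : x = q <;> by_cases hy : y = q
    · simp [hx, hy]
    · have := dist_pos.2 hy
      simp only [hx, hy, if_true, if_false, hD.1]
      rw [dist_comm, dist_comm q y]
      field_simp
    · have := dist_pos.2 hx
      simp only [hx, hy, if_true, if_false, hD.1]
      field_simp
    · have hx0 := dist_pos.2 hx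
      have hy0 := dist_pos.2 hy
      simp only [hx, hy, if_false]
      rw [dist_eq_stereo (p := p) (hD.2 x hx).1 (hD.2 y hy).1, (hD.2 x hx).2, (hD.2 y hy).2,
        dist_smul₀, Real.norm_of_nonneg hc.le, dist_stereo hx hy]
      field_simp
      rw [Real.sq_sqrt hc.le]
      ring

/-- Quasiconformality of the infinite product of conjugates of a quasiconformal map. -/
theorem IsLift.isQuasiconformal_swindle {f g : Sph n ≃ₜ Sph n}
    {F G : EuclideanSpace ℝ (Fin n) → EuclideanSpace ℝ (Fin n)}
    (hf : IsLift q p f F) (hg : IsLift q p g G) {b c r δ : ℝ} (hc0 : 0 < c) (hc : c < 1)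
    (hr : 0 < r) (hcr : c * r < b) (hδ : 0 < δ) (hfix : FixesNear q δ f)
    (hF₁ : ∀ y, c * r < ‖y‖ → F y = G y) (hF₂ : ∀ y, ‖y‖ < b → F y = c • F (c⁻¹ • y))
    (hF₃ : ∀ y, ‖F y‖ ≤ c⁻¹ * ‖y‖ ∧ ‖y‖ ≤ c⁻¹ * ‖F y‖) (hgq : IsQuasiconformal g) :
    IsQuasiconformal f := by
  obtain ⟨K, hK⟩ := isQuasiconformal_iff.1 hgq
  set A := max 1 (2 / δ)
  have hA1 : 1 ≤ A := le_max_left _ _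
  -- One bound for each kind of point: near `q` the map is the identity, and `17` exceeds `16 * 1 ^
  -- 2`; at the chart origin `hF₃` gives distortion at most `c⁻¹ * A`; elsewhere the bound `K` of
  -- `g` is inherited.
  set K' : ℝ≥0 := max K (max 17 (16 * (c⁻¹ * A) ^ 2 + 1).toNNReal)
  refine isQuasiconformal_iff.2 ⟨K', fun x => ?_⟩
  rcases eq_or_ne x q with rfl | hx
  · refine DilatationLT.mono (K := 17) ?_ ((le_max_left _ _).trans (le_max_right _ _))
    refine dilatationLT_of_bounds one_pos (by norm_num) ?_
    filter_upwards [Metric.ball_mem_nhds x hδ] with z hz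
    rw [hfix z hz, hf.1, one_mul]
    exact ⟨le_rfl, le_rfl⟩
  rcases eq_or_ne (stereo q p x) 0 with h0 | h0
  · refine DilatationLT.mono (K := (16 * (c⁻¹ * A) ^ 2 + 1).toNNReal) ?_
      ((le_max_right _ _).trans (le_max_right _ _))
    have hF0 : F 0 = 0 := by simpa using (hF₃ 0).1
    have hfx : f x = x := hf.eq_of_eq isLift_id hx (by rw [h0, hF0]; rfl)
    refine dilatationLT_of_bounds (A := c⁻¹ * A) (by positivity) ?_ ?_
    · rw [Real.coe_toNNReal _ (by positivity)]; linarith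
    filter_upwards [isOpen_compl_singleton.mem_nhds hx] with z hz
    rw [hfx, dist_eq_stereo (p := p) (hf.2 z hz).1 hx, dist_eq_stereo (p := p) hz hx, h0,
      dist_zero_right, dist_zero_right, (hf.2 z hz).2]
    have h1 := hfix.dist_le hδ z
    have h2 := hfix.dist_ge hδ z
    obtain ⟨h3, h4⟩ := hF₃ (stereo q p z)
    constructor
    · calc _ ≤ c⁻¹ * ‖stereo q p z‖ * (A * dist z q * dist x q) / 4 := by gcongr
        _ = _ := by ring
    · calc _ ≤ c⁻¹ * ‖F (stereo q p z)‖ * (A * dist (f z) q * dist x q) / 4 := by gcongr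
        _ = _ := by ring
  have hev : ∀ (y : EuclideanSpace ℝ (Fin n)) (S : Set (EuclideanSpace ℝ (Fin n))), IsOpen S →
      y ∈ S → ∀ᶠ z in 𝓝 (stereoInv q p y), z ≠ q ∧ stereo q p z ∈ S := by
    intro y S hS hy
    refine Eventually.and (isOpen_compl_singleton.mem_nhds (stereoInv_ne y))
      ((continuousAt_stereo (stereoInv_ne y)).eventually (hS.mem_nhds ?_))
    rwa [stereo_stereoInv]
  rw [← stereoInv_stereo (p := p) hx]
  -- On the outer region `f` agrees locally with `g`; deeper in, it is locally the conjugate by a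
  -- Möbius dilation of its germ one shell further out.
  refine of_annulus (p := fun y => DilatationLT K' f (stereoInv q p y)) hc0 hc hr ?_ ?_ h0
  · intro y hy
    refine ((hK (stereoInv q p y)).mono (le_max_left _ _)).congr f.continuous.continuousAt ?_
    filter_upwards [hev y _ (isOpen_lt continuous_const continuous_norm) hy] with z hz
    exact hf.eq_of_eq hg hz.1 (hF₁ _ hz.2)
  · intro y hy ih
    have hD : IsLift q p (stereoLift q p (Homeomorph.smulOfNeZero c hc0.ne').toEquiv)
      fun y => c • y := isLift_stereoLift _
    have hD' : IsLift q p (stereoLift q p (Homeomorph.smulOfNeZero c hc0.ne').toEquiv).symm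
      fun y => c⁻¹ • y := isLift_stereoLift _
    have hm := isMobius_stereoLift (q := q) (p := p) hc0
    set D := stereoLift q p (Homeomorph.smulOfNeZero c hc0.ne').toEquiv
    have hDy : D (stereoInv q p (c⁻¹ • y)) = stereoInv q p y := by
      have h1 := hD.2 _ (stereoInv_ne (q := q) (p := p) (c⁻¹ • y))
      refine stereo_inj (p := p) h1.1 (stereoInv_ne y) ?_
      rw [h1.2, stereo_stereoInv, stereo_stereoInv]
      exact smul_inv_smul₀ hc0.ne' y
    rw [← hDy]
    refine DilatationLT.conj_mobius (f := f) hm f.continuous.continuousAt ?_ ih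
    rw [hDy]
    filter_upwards [hev y _ (isOpen_lt continuous_norm continuous_const) (hy.trans_lt hcr)]
      with z hz
    exact hf.eq_of_eq (hD.comp (hf.comp hD')) hz.1 (hF₂ _ hz.2)

end Lift

/-! ### Maps that are the identity near a point have degree 1. -/

section Orientation

variable {n : ℕ} {q : Sph n} {δ : ℝ}

open Classical in
/-- The straight line homotopy in the stereographic chart with pole `q`. -/
noncomputable def lineHomotopy (q : Sph n) (f : Sph n → Sph n) (t : unitInterval × Sph n) : Sph n :=
  if t.2 = q then q
  else stereoInv q 0 (AffineMap.lineMap (stereo q 0 (f t.2)) (stereo q 0 t.2) (t.1 : ℝ))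

theorem FixesNear.continuous_lineHomotopy {f : Sph n ≃ₜ Sph n} (hδ : 0 < δ)
    (hf : FixesNear q δ f) : Continuous (lineHomotopy q f) := by
  have hq : f q = q := hf q (by simpa using hδ)
  rw [continuous_iff_continuousAt]
  rintro ⟨t, x⟩
  rcases eq_or_ne x q with rfl | hx
  · have : ContinuousAt (fun s : unitInterval × Sph n => s.2) (t, x) := continuousAt_snd
    refine this.congr ?_
    filter_upwards [continuousAt_snd.eventually (Metric.ball_mem_nhds x hδ)] with s hs
    rw [lineHomotopy]
    split_ifs with h
    · exact h
    · rw [hf _ hs, AffineMap.lineMap_same_apply, stereoInv_stereo h]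
  · have hfx : f x ≠ q := fun h => hx (f.injective (h.trans hq.symm))
    have h1 : ContinuousAt (fun s : unitInterval × Sph n => stereo q 0 (f s.2)) (t, x) :=
      ContinuousAt.comp (f := fun s : unitInterval × Sph n => f s.2) (continuousAt_stereo hfx)
        (f.continuous.comp continuous_snd).continuousAt
    have h2 : ContinuousAt (fun s : unitInterval × Sph n => stereo q 0 s.2) (t, x) :=
      ContinuousAt.comp (f := fun s : unitInterval × Sph n => s.2) (continuousAt_stereo hx)
        continuousAt_snd
    have h3 : ContinuousAt (fun s : unitInterval × Sph n => (s.1 : ℝ)) (t, x) :=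
      (continuous_subtype_val.comp continuous_fst).continuousAt
    have : ContinuousAt (fun s : unitInterval × Sph n => stereoInv q 0
        (AffineMap.lineMap (stereo q 0 (f s.2)) (stereo q 0 s.2) (s.1 : ℝ))) (t, x) := by
      refine continuous_stereoInv.continuousAt.comp ?_
      simp only [AffineMap.lineMap_apply_module]
      exact ((continuousAt_const.sub h3).smul h1).add (h3.smul h2)
    refine this.congr ?_
    filter_upwards [continuousAt_snd.eventually (isOpen_compl_singleton.mem_nhds hx)] with s hs
    exact (if_neg hs).symm

/-- A homeomorphism which is the identity near a point is homotopic to the identity. -/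
theorem FixesNear.homotopic_id {f : Sph n ≃ₜ Sph n} (hδ : 0 < δ) (hf : FixesNear q δ f) :
    Nonempty ((f : C(Sph n, Sph n)).Homotopy (ContinuousMap.id _)) := by
  have hq : f q = q := hf q (by simpa using hδ)
  refine ⟨⟨⟨lineHomotopy q f, hf.continuous_lineHomotopy hδ⟩, fun x => ?_, fun x => ?_⟩⟩
  · change lineHomotopy q f (0, x) = f x
    rcases eq_or_ne x q with rfl | hx
    · simp [lineHomotopy, hq]
    · have hfx : f x ≠ q := fun h => hx (f.injective (h.trans hq.symm))
      simp [lineHomotopy, hx, stereoInv_stereo hfx]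
  · change lineHomotopy q f (1, x) = x
    rcases eq_or_ne x q with rfl | hx
    · simp [lineHomotopy]
    · simp [lineHomotopy, hx, stereoInv_stereo hx]

theorem FixesNear.orientationPreserving {f : Sph n ≃ₜ Sph n} (hδ : 0 < δ)
    (hf : FixesNear q δ f) : OrientationPreserving f := by
  obtain ⟨H⟩ := hf.homotopic_id hδ
  have H' : TopCat.Homotopy (TopCat.ofHom (f : C(Sph n, Sph n)))
      (CategoryTheory.CategoryStruct.id (TopCat.of (Sph n))) := H
  have := H'.congr_homologyMap_singularChainComplexFunctor (ModuleCat.of ℤ ℤ) n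
  refine Eq.trans this ?_
  exact ((AlgebraicTopology.singularHomologyFunctor (ModuleCat.{0} ℤ) n).obj
    (ModuleCat.of ℤ ℤ)).map_id (TopCat.of (Sph n))

end Orientation

/-! ### Support in a ball as triviality near a point. -/

section BallSupported

variable {n : ℕ} {q : Sph n} {δ : ℝ} {G : Set (Sph n ≃ₜ Sph n)}

theorem sphDist_neg_right (x c : Sph n) : sphDist x (-c) = Real.pi - sphDist x c :=
  InnerProductGeometry.angle_neg_right _ _

/-- The complement of the ball of radius `ε` about `c` is the closed ball of radius `π - ε` about
`-c`. -/
theorem mem_ballSupported_iff {f : Sph n ≃ₜ Sph n} :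
    f ∈ ballSupported G ↔ f ∈ G ∧ ∃ q, ∃ δ > 0, FixesNear q δ f := by
  have hp := Real.pi_pos
  refine and_congr_right fun _ => ⟨?_, ?_⟩
  · rintro ⟨_, ⟨c, ε, hε, hεπ, rfl⟩, hf⟩
    refine ⟨-c, (Real.pi - ε) / (Real.pi / 2), div_pos (by linarith) (by linarith),
      fun x hx => hf x ?_⟩
    rw [lt_div_iff₀ (by positivity)] at hx
    have h1 := sphDist_le_dist x (-c)
    rw [sphDist_neg_right] at h1
    change ¬ sphDist x c < ε
    linarith
  · rintro ⟨q, δ, hδ, hf⟩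
    have hm : 0 < min δ 1 := by positivity
    refine ⟨_, ⟨-q, Real.pi - min δ 1 / 2, ?_, by linarith, rfl⟩, fun x hx => hf x ?_⟩
    · linarith [min_le_right δ 1, Real.pi_gt_three]
    · change ¬ sphDist x (-q) < _ at hx
      rw [sphDist_neg_right] at hx
      linarith [dist_le_sphDist x q, min_le_left δ 1]

theorem FixesNear.mem_ballGenerated {f : Sph n ≃ₜ Sph n} (hf : FixesNear q δ f) (hδ : 0 < δ)
    (hG : f ∈ G) : f ∈ ballGenerated G :=
  Subgroup.subset_closure (mem_ballSupported_iff.2 ⟨hG, q, δ, hδ, hf⟩)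

end BallSupported

/-! ### The simplicity argument. -/

section Group

theorem commute_of_disjoint_support {X : Type*} [TopologicalSpace X] {f g : X ≃ₜ X}
    (h : ∀ x, f x = x ∨ g x = x) : f * g = g * f := by
  have key : ∀ (f g : X ≃ₜ X), (∀ x, f x = x ∨ g x = x) → ∀ x, g x = x → f (g x) = g (f x) := by
    intro f g h x hx
    rw [hx]
    rcases h (f x) with h1 | h1
    · rw [f.injective h1, hx]
    · exact h1.symm
  ext x
  change f (g x) = g (f x)
  rcases h x with h1 | h1
  · exact (key g f (fun x => (h x).symm) x h1).symm
  · exact key f g h x h1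

/-- If an element of a normal subgroup moves `S` off itself, then the normal subgroup contains
the commutators of the elements supported on `S`. -/
theorem commutator_mem_of_displaced {X : Type*} [TopologicalSpace X] {H : Subgroup (X ≃ₜ X)}
    {N : Subgroup H} [N.Normal] {S : Set X} {a b β : H} (hβ : β ∈ N)
    (hS : ∀ x ∈ S, (β : X ≃ₜ X) x ∉ S) (ha : ∀ x ∉ S, (a : X ≃ₜ X) x = x)
    (hb : ∀ x ∉ S, (b : X ≃ₜ X) x = x) : a * b * a⁻¹ * b⁻¹ ∈ N := by
  -- This conjugate is supported on the image of `S` under `β`, which misses `S`, so it commutes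
  -- with `b`. Hence `a` may be replaced by the commutator of `a` and `β`, an element of `N`,
  -- without changing its commutator with `b`.
  have hcomm : β * a⁻¹ * β⁻¹ * b = b * (β * a⁻¹ * β⁻¹) := by
    refine Subtype.ext (commute_of_disjoint_support fun x => ?_)
    by_cases hx : x ∈ S
    · left
      have h1 : (β : X ≃ₜ X).symm x ∉ S := fun h => hS _ h (by simpa using hx)
      change (β : X ≃ₜ X) ((a : X ≃ₜ X).symm ((β : X ≃ₜ X).symm x)) = x
      rw [(a : X ≃ₜ X).symm_apply_eq.2 (ha _ h1).symm, Homeomorph.apply_symm_apply]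
    · exact Or.inr (hb x hx)
  have hc : a * β * a⁻¹ * β⁻¹ ∈ N :=
    N.mul_mem (Subgroup.Normal.conj_mem inferInstance β hβ a) (N.inv_mem hβ)
  have hd := N.mul_mem hc (Subgroup.Normal.conj_mem inferInstance _ (N.inv_mem hc) b)
  have e : a * b * a⁻¹ * b⁻¹ = a * β * a⁻¹ * β⁻¹ * (b * (a * β * a⁻¹ * β⁻¹)⁻¹ * b⁻¹) := by
    have e1 : a * β * a⁻¹ * β⁻¹ = a * (β * a⁻¹ * β⁻¹) := by group
    rw [e1]
    generalize β * a⁻¹ * β⁻¹ = c at hcomm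
    rw [mul_inv_rev]
    calc a * b * a⁻¹ * b⁻¹ = a * (b * c) * c⁻¹ * a⁻¹ * b⁻¹ := by group
      _ = _ := by rw [← hcomm]; group
  rw [e]
  exact hd

variable {n : ℕ} {G : Set (Sph n ≃ₜ Sph n)}

theorem exists_ne_ne_ne (hn : 1 ≤ n) (q : Sph n) : ∃ w u : Sph n, w ≠ q ∧ u ≠ q ∧ w ≠ u := by
  have : NeZero n := ⟨by omega⟩
  obtain ⟨y, hy⟩ := exists_ne (0 : EuclideanSpace ℝ (Fin n))
  refine ⟨stereoInv q 0 0, stereoInv q 0 y, stereoInv_ne _, stereoInv_ne _, fun h => hy ?_⟩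
  rw [← stereo_stereoInv (q := q) (p := 0) y, ← h, stereo_stereoInv]

/-- Closure of `G` under composition plays no role: the maps supplied by `hcomm` and `hsqueeze` are
themselves generators. -/
theorem isSimpleGroup_ballGenerated (hn : 1 ≤ n)
    (hcomm : ∀ g ∈ G, ∀ (q : Sph n) (δ : ℝ), 0 < δ → FixesNear q δ g →
      ∃ F ∈ G, ∃ φ ∈ G, ∃ δ' > 0, FixesNear q δ' F ∧ FixesNear q δ' φ ∧ g * φ * F = F * φ)
    (hsqueeze : ∀ (q : Sph n) (δ : ℝ), 0 < δ → ∀ w, w ≠ q → ∀ W ∈ 𝓝 w, ∃ h ∈ G,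
      (∃ δ' > 0, FixesNear q δ' h) ∧ ∀ x, δ ≤ dist x q → h x ∈ W) :
    IsSimpleGroup (ballGenerated G) := by
  have : Nontrivial (ballGenerated G) := by
    obtain ⟨q⟩ : Nonempty (Sph n) := ⟨⟨EuclideanSpace.single 0 1, by simp⟩⟩
    obtain ⟨w, u, hw, hu, hwu⟩ := exists_ne_ne_ne hn q
    -- Squeezing `u` into the complement of `u` produces a nontrivial element.
    obtain ⟨h, hG, ⟨δ, hδ, hf⟩, hW⟩ := hsqueeze q (dist u q) (dist_pos.2 hu) w hw {u}ᶜ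
      (isOpen_compl_singleton.mem_nhds hwu)
    refine ⟨⟨⟨h, hf.mem_ballGenerated hδ hG⟩, 1, fun e => hW u le_rfl ?_⟩⟩
    have e' : h = 1 := congrArg Subtype.val e
    rw [e']
    rfl
  refine { eq_bot_or_eq_top_of_normal := fun N hN => or_iff_not_imp_left.2 fun hbot => ?_ }
  obtain ⟨⟨α, hα⟩, hα'⟩ := Subgroup.ne_bot_iff_exists_ne_one.1 hbot
  have hα1 : α ≠ 1 := fun h => hα' (Subtype.ext h)
  obtain ⟨x₀, hx₀⟩ : ∃ x, α.1 x ≠ x := by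
    by_contra! h
    exact hα1 (Subtype.ext (Homeomorph.ext h))
  have hgen : ∀ g ∈ ballSupported G, ∀ hg : g ∈ ballGenerated G,
      (⟨g, hg⟩ : ballGenerated G) ∈ N := by
    intro g hg hgH
    obtain ⟨hgG, q, δ, hδ, hgf⟩ := mem_ballSupported_iff.1 hg
    -- Squeezing needs a target other than `q`; if the moved point is `q`, its image is moved as
    -- well.
    obtain ⟨x, hxq, hx⟩ : ∃ x, x ≠ q ∧ α.1 x ≠ x := by
      by_cases h : x₀ = q
      · exact ⟨α.1 x₀, h ▸ hx₀, fun h' => hx₀ (α.1.injective h')⟩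
      · exact ⟨x₀, h, hx₀⟩
    obtain ⟨F, hF, φ, hφ, δ', hδ', hFf, hφf, he⟩ := hcomm g hgG q δ hδ hgf
    obtain ⟨U, V, hU, hV, hxU, hxV, hUV⟩ := t2_separation hx.symm
    obtain ⟨h, hhG, ⟨δh, hδh, hhf⟩, hh⟩ := hsqueeze q δ' hδ' x hxq (U ∩ α.1 ⁻¹' V)
      (inter_mem (hU.mem_nhds hxU) (α.1.continuous.continuousAt (hV.mem_nhds hxV)))
    set a : ballGenerated G := ⟨F, hFf.mem_ballGenerated hδ' hF⟩
    set b : ballGenerated G := ⟨φ, hφf.mem_ballGenerated hδ' hφ⟩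
    set k : ballGenerated G := ⟨h, hhf.mem_ballGenerated hδh hhG⟩
    have hβ : k⁻¹ * α * k ∈ N := by simpa using hN.conj_mem α hα k⁻¹
    have hmem := commutator_mem_of_displaced (S := {x | δ' ≤ dist x q}) (a := a) (b := b) hβ
      (fun y hy hy' => ?_) (fun y hy => hFf y (not_le.1 hy)) (fun y hy => hφf y (not_le.1 hy))
    · convert hmem using 1
      refine Subtype.ext ?_
      change g = F * φ * F⁻¹ * φ⁻¹
      rw [← he]
      group
    · have h1 := hh _ hy'
      have h2 := hh _ hy
      have e : h (((k⁻¹ * α * k : ballGenerated G) : Sph n ≃ₜ Sph n) y) = α.1 (h y) :=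
        h.apply_symm_apply _
      rw [e] at h1
      exact Set.disjoint_left.1 hUV h1.1 h2.2
  refine (Subgroup.eq_top_iff' N).2 fun ⟨g, hg⟩ => ?_
  refine Subgroup.closure_induction (p := fun g hg => (⟨g, hg⟩ : ballGenerated G) ∈ N)
    (fun g hg => hgen g hg _) N.one_mem (fun g h _ _ hg hh => N.mul_mem hg hh)
    (fun g _ hg => N.inv_mem hg) hg

end Group

/-! ### The commutator and squeezing constructions on the sphere. -/

section Main

variable {n : ℕ}

theorem exists_commutator (hn : 1 ≤ n) (g : Sph n ≃ₜ Sph n) (q : Sph n) {δ : ℝ} (hδ : 0 < δ)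
    (hg : FixesNear q δ g) : ∃ F φ : Sph n ≃ₜ Sph n, ∃ δ' > 0, FixesNear q δ' F ∧
      FixesNear q δ' φ ∧ IsBilipschitz φ ∧ (IsQuasiconformal g → IsQuasiconformal F) ∧
      (IsBilipschitz g → IsBilipschitz F) ∧ g * φ * F = F * φ := by
  have : NeZero n := ⟨by omega⟩
  obtain ⟨R, hR⟩ := exists_norm_stereo_le q 0 hδ
  have hR0 := abs_nonneg R
  -- The support of `g` lies in the chart ball of radius `|R|` about 0. Recentring at a point of
  -- norm `|R| + 2` places it at norms between 2 and `2 * |R| + 2`, inside the annulus from `b = 1`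
  -- to `r`.
  obtain ⟨p, hp⟩ := exists_norm_eq (EuclideanSpace ℝ (Fin n)) (show 0 ≤ |R| + 2 by positivity)
  obtain ⟨gE, hgE⟩ := exists_isLift_of_fixed p g (hg q (by simpa using hδ))
  set r := 2 * |R| + 4 with hr
  have hr0 : 0 < r := by positivity
  have hfix : ∀ y, ‖y‖ < 1 ∨ r ≤ ‖y‖ → gE y = y := by
    intro y hy
    refine hgE.eq_self_of_fixesNear hg (not_le.1 fun h => ?_)
    have h1 := (hR _ h).trans (le_abs_self R)
    have h2 : stereo q 0 (stereoInv q p y) = y + p := by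
      have := stereo_stereoInv (q := q) (p := p) y
      rw [stereo] at this ⊢
      rw [sub_zero, ← this, sub_add_cancel, this]
    rw [h2] at h1
    have h3 : ‖p‖ ≤ ‖y + p‖ + ‖y‖ := by simpa using norm_sub_le (y + p) y
    have h4 : ‖y‖ ≤ ‖y + p‖ + ‖p‖ := by simpa using norm_sub_le (y + p) p
    rcases hy with hy | hy <;> linarith
  -- Chosen so that `c * r = 1 / 2` stays below the inner radius `b = 1`.
  set c := 1 / (2 * r) with hc
  have hc0 : 0 < c := by positivity
  have hcr : c * r = 1 / 2 := by rw [hc]; field_simp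
  have hc1 : c < 1 := by nlinarith
  have hcr1 : c * r < 1 := by rw [hcr]; norm_num
  obtain ⟨FE, hF₁, hF₂, hF₃, hF₄, hF₅, hF₆, hF₇⟩ := exists_swindle hc0 hc1 hr0 hcr1 gE hfix
  obtain ⟨φE, hφ₁, hφ₂, hφ₃, ⟨M₁, hM₁⟩, ⟨M₂, hM₂⟩⟩ :=
    exists_shrink (E := EuclideanSpace ℝ (Fin n)) hc0 hc1 hr0
  obtain ⟨F, hF⟩ := exists_isLift (q := q) (p := p) FE hF₁
  obtain ⟨φ, hφ⟩ := exists_isLift (q := q) (p := p) φE hφ₂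
  obtain ⟨δ₁, hδ₁, hFf⟩ := hF.fixesNear hF₁
  obtain ⟨δ₂, hδ₂, hφf⟩ := hφ.fixesNear hφ₂
  refine ⟨F, φ, min δ₁ δ₂, by positivity, hFf.mono (min_le_left _ _), hφf.mono (min_le_right _ _),
    isBilipschitz_iff.2 ⟨hφ.dist_le hδ₂ hφf hM₁, hφ.symm.dist_le hδ₂ hφf.symm hM₂⟩,
    hF.isQuasiconformal_swindle hgE hc0 hc1 hr0 hcr1 hδ₁ hFf hF₂ hF₃ hF₄, fun hgb => ?_, ?_⟩
  · obtain ⟨⟨L₁, hL₁⟩, ⟨L₂, hL₂⟩⟩ := isBilipschitz_iff.1 hgb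
    obtain ⟨K₁, hK₁, hK₁'⟩ := hgE.dist_le_of_dist_le hδ hg hL₁
    obtain ⟨K₂, hK₂, hK₂'⟩ := hgE.symm.dist_le_of_dist_le hδ hg.symm hL₂
    exact isBilipschitz_iff.2 ⟨hF.dist_le hδ₁ hFf (hF₆ _ hK₁ hK₁'),
      hF.symm.dist_le hδ₁ hFf.symm (hF₇ _ hK₂ hK₂')⟩
  · ext1 x
    change g (φ (F x)) = F (φ x)
    rcases eq_or_ne x q with rfl | hx
    · rw [hF.1, hφ.1, hF.1, hgE.1]
    · exact (hgE.comp (hφ.comp hF)).eq_of_eq (hF.comp hφ) hx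
        (swindle_commutes hc0 hcr1 hfix hF₁ hF₂ hF₃ hF₅ hφ₁ hφ₃ _)

theorem exists_squeeze (q : Sph n) {δ : ℝ} (hδ : 0 < δ) {w : Sph n} (hw : w ≠ q) {W : Set (Sph n)}
    (hW : W ∈ 𝓝 w) : ∃ h : Sph n ≃ₜ Sph n, IsBilipschitz h ∧ (∃ δ' > 0, FixesNear q δ' h) ∧
      ∀ x, δ ≤ dist x q → h x ∈ W := by
  set p := stereo q 0 w
  have hw0 : stereoInv q p 0 = w := by
    have := stereoInv_stereo (p := 0) hw
    rw [stereoInv, add_zero] at this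
    rw [stereoInv, zero_add]
    exact this
  obtain ⟨R, hR⟩ := exists_norm_stereo_le q p hδ
  obtain ⟨η, hη, hηW⟩ := Metric.mem_nhds_iff.1
    ((continuous_stereoInv (q := q) (p := p)).continuousAt (x := 0) (hw0.symm ▸ hW))
  set r := |R| + 1
  have hr0 : 0 < r := by positivity
  -- Multiplication by `c` takes the ball of radius `r` into that of radius `η / 2`; the `1 / 2`
  -- ensures `c < 1`.
  set c := min (1 / 2) (η / (2 * r))
  have hc0 : 0 < c := by positivity
  have hc1 : c < 1 := lt_of_le_of_lt (min_le_left _ _) (by norm_num)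
  obtain ⟨φE, hφ₁, hφ₂, -, ⟨M₁, hM₁⟩, ⟨M₂, hM₂⟩⟩ :=
    exists_shrink (E := EuclideanSpace ℝ (Fin n)) hc0 hc1 hr0
  obtain ⟨φ, hφ⟩ := exists_isLift (q := q) (p := p) φE hφ₂
  obtain ⟨δ', hδ', hφf⟩ := hφ.fixesNear hφ₂
  refine ⟨φ, isBilipschitz_iff.2 ⟨hφ.dist_le hδ' hφf hM₁, hφ.symm.dist_le hδ' hφf.symm hM₂⟩,
    ⟨δ', hδ', hφf⟩, fun x hx => ?_⟩
  have hxq : x ≠ q := dist_pos.1 (hδ.trans_le hx)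
  have hxr : ‖stereo q p x‖ ≤ r := by linarith [hR x hx, le_abs_self R]
  rw [← stereoInv_stereo (p := p) (hφ.2 x hxq).1]
  refine hηW ?_
  rw [(hφ.2 x hxq).2, hφ₁ _ hxr, mem_ball_zero_iff, norm_smul, Real.norm_of_nonneg hc0.le]
  calc c * ‖stereo q p x‖ ≤ η / (2 * r) * r := by gcongr; exact min_le_right _ _
    _ = η / 2 := by field_simp
    _ < η := by linarith

theorem isSimpleGroup_ballGenerated_QC (hn : 1 ≤ n) : IsSimpleGroup (ballGenerated (QC n)) := by
  refine isSimpleGroup_ballGenerated hn (fun g hg q δ hδ hf => ?_) (fun q δ hδ w hw W hW => ?_)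
  · obtain ⟨F, φ, δ', hδ', hF, hφ, hφb, hq, -, he⟩ := exists_commutator hn g q hδ hf
    exact ⟨F, ⟨hq hg.1, hF.orientationPreserving hδ'⟩, φ,
      ⟨hφb.isQuasiconformal, hφ.orientationPreserving hδ'⟩, δ', hδ', hF, hφ, he⟩
  · obtain ⟨h, hb, ⟨δ', hδ', hf⟩, hW⟩ := exists_squeeze q hδ hw hW
    exact ⟨h, ⟨hb.isQuasiconformal, hf.orientationPreserving hδ'⟩, ⟨δ', hδ', hf⟩, hW⟩

theorem isSimpleGroup_ballGenerated_LIP (hn : 1 ≤ n) : IsSimpleGroup (ballGenerated (LIP n)) := by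
  refine isSimpleGroup_ballGenerated hn (fun g hg q δ hδ hf => ?_) (fun q δ hδ w hw W hW => ?_)
  · obtain ⟨F, φ, δ', hδ', hF, hφ, hφb, -, hb, he⟩ := exists_commutator hn g q hδ hf
    exact ⟨F, ⟨hb hg.1, hF.orientationPreserving hδ'⟩, φ,
      ⟨hφb, hφ.orientationPreserving hδ'⟩, δ', hδ', hF, hφ, he⟩
  · obtain ⟨h, hb, ⟨δ', hδ', hf⟩, hW⟩ := exists_squeeze q hδ hw hW
    exact ⟨h, ⟨hb, hf.orientationPreserving hδ'⟩, ⟨δ', hδ', hf⟩, hW⟩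

end Main

end SphereHomeo

theorem mainTheorem5 (n : ℕ) (hn : 2 ≤ n) :
    IsSimpleGroup (SphereHomeo.ballGenerated (SphereHomeo.QC n)) ∧
      IsSimpleGroup (SphereHomeo.ballGenerated (SphereHomeo.LIP n)) :=
  ⟨SphereHomeo.isSimpleGroup_ballGenerated_QC (by omega),
    SphereHomeo.isSimpleGroup_ballGenerated_LIP (by omega)⟩
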